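/- Let $M>0$ and $q\in[0,1]$ with $2M\ge q$. Let $\mathcal K^M_q$ be the set of functions $u:[-1,1]\to[0,M]$ that are $q$-concave, i.e. such that $x\mapsto u(x)-\tfrac q2x^2$ is concave on $[-1,1]$. (Such a $u$ is differentiable almost everywhere.) Then the problem $$\min_{u\in\mathcal K^M_q}\int_{-1}^1\frac{dx}{1+u'(x)^2}$$ has a solution, and it is unique as a function on $[-1,1]$. It is the following function $u_{M;q}$. If $M\ge 1$, then $u_{M;q}(x)=M(1-|x|)$. If $M<1$, then $$u_{M;q}(x)=\begin{cases}\dfrac q2\,(x^2-\gamma^2)+M & \text{if } |x|\le\gamma,\\[1ex] \dfrac{M}{1-\gamma}\,(1-|x|) & \text{if } \gamma\le|x|\le1,\end{cases}$$ where $\gamma=\gamma_{M;q}$ is the unique minimizer on $[0,1]$ of the function $$R_{M;q}(\gamma)=\begin{cases}\dfrac2q\arctan(q\gamma)+\dfrac{2(1-\gamma)^3}{M^2+(1-\gamma)^2} & \text{if } q>0,\\[1ex] 2\gamma+\dfrac{2(1-\gamma)^3}{M^2+(1-\gamma)^2} & \text{if } q=0;\end{cases}$$ this minimizer exists, is unique,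 and lies in the open interval $(0,1)$. -/

import Mathlib

open Set MeasureTheory

/-- `u` is `q`-concave on `s`: the map `x ↦ u x - (q / 2) x ^ 2` is concave on `s`. -/
def QConcaveOn (q : ℝ) (s : Set ℝ) (u : ℝ → ℝ) : Prop :=
  ConcaveOn ℝ s (fun x => u x - q / 2 * x ^ 2)

/-- The one-dimensional Newton resistance `∫_a^b dx / (1 + u'(x)^2)`. A `q`-concave function is
differentiable at almost every point of the interval, so the value of `deriv` at the remaining
points plays no role; the integrand is measurable with values in `(0, 1]`, hence integrable. -/
noncomputable def resistance (a b : ℝ) (u : ℝ → ℝ) : ℝ :=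
  ∫ x in a..b, 1 / (1 + deriv u x ^ 2)

/-- The admissible profiles: `q`-concave functions `[-1, 1] → [0, M]`. A function on `[-1, 1]` is
represented by any extension to `ℝ`; nothing below depends on the values outside `[-1, 1]`. -/
def admissibleProfiles (M q : ℝ) : Set (ℝ → ℝ) :=
  {u | MapsTo u (Icc (-1) 1) (Icc 0 M) ∧ QConcaveOn q (Icc (-1) 1) u}

/-- `u` solves the problem of minimal resistance among the admissible profiles. -/
def IsSolution (M q : ℝ) (u : ℝ → ℝ) : Prop :=
  u ∈ admissibleProfiles M q ∧ IsMinOn (resistance (-1) 1) (admissibleProfiles M q) u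

/-- `u` is a solution, and every solution coincides with `u` on the whole of `[-1, 1]`. -/
def IsUniqueSolution (M q : ℝ) (u : ℝ → ℝ) : Prop :=
  IsSolution M q u ∧ ∀ v : ℝ → ℝ, IsSolution M q v → EqOn v u (Icc (-1) 1)

/-- The function `R_{M;q}`. -/
noncomputable def reducedResistance (M q γ : ℝ) : ℝ :=
  if 0 < q then
    2 / q * Real.arctan (q * γ) + 2 * (1 - γ) ^ 3 / (M ^ 2 + (1 - γ) ^ 2)
  else
    2 * γ + 2 * (1 - γ) ^ 3 / (M ^ 2 + (1 - γ) ^ 2)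

/-- The profile made of a parabola with second derivative `q` on `|x| ≤ γ` and of two linear sides
descending from height `M` at `|x| = γ` to height `0` at `|x| = 1`. -/
noncomputable def parabolicProfile (M q γ x : ℝ) : ℝ :=
  if |x| ≤ γ then q / 2 * (x ^ 2 - γ ^ 2) + M else M / (1 - γ) * (1 - |x|)

/-- The tent `M (1 - |x|)`. -/
noncomputable def tentProfile (M x : ℝ) : ℝ := M * (1 - |x|)

/-! Split `[-1, 1]` into the valleys of a profile `u`, the points with strictly higher points on
both sides, and the rest, where `u` agrees with the running maximum taken from an endpoint towards a
maximum point `c`. The two parts are bounded below separately, and the bound depends only on `σ`,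
half the measure of the valleys.

Outside the valleys, replace the pressure by its tangent line at a slope `m ≥ 1`, which lies below
it as a function of `|u'|`. The integral of `|u'|` there is at most the total rise of the two
running maxima, hence at most `2 * M`.

Inside the valleys, let `κ` be the greatest depth and `d` the bottom of a deepest valley. At a point
of slope `p`, `q`-concavity puts `u` below a parabola of second derivative `q` tangent to it; its
vertex lies inside the valley, `p ^ 2 / (2 * q)` lower. Hence `|p| ≤ q * s` with `q * s ^ 2 = 2 *
κ`, and within distance `s` of `d` also `|p| ≤ q * |x - d|`. Integrating, the valleys resist at
least as much as a single parabolic valley of half-width `σ`.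

With `m = M / (1 - σ)` the sum is exactly `reducedResistance M q σ`; if that slope is below 1, `m =
1` gives the value at `1 - M` instead. The assumption `q ≤ 1` makes `reducedResistance M q` strictly
unimodal. For a minimizer all these inequalities are equalities, which fixes its heights, its slopes
and, when `q > 0`, its valley. Stationarity gives `q * γ < m`, so a central parabola detached from
the maximum point would create a convex kink, which `q`-concavity forbids. -/

open Filter Topology

/-! ### The pressure and its tangent lines -/

/-- The pressure `1 / (1 + p ^ 2)` on a facet of slope `p`. -/
noncomputable def drag (p : ℝ) : ℝ := 1 / (1 + p ^ 2)

/-- The value at `0` of the tangent line to `drag` at `m`. -/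
noncomputable def tangentIntercept (m : ℝ) : ℝ := (1 + 3 * m ^ 2) / (1 + m ^ 2) ^ 2

/-- The opposite of the slope of the tangent line to `drag` at `m`. -/
noncomputable def tangentDecay (m : ℝ) : ℝ := 2 * m / (1 + m ^ 2) ^ 2

theorem drag_pos (p : ℝ) : 0 < drag p := by unfold drag; positivity

theorem drag_le_one (p : ℝ) : drag p ≤ 1 := by
  unfold drag
  rw [div_le_one (by positivity)]
  nlinarith [sq_nonneg p]

theorem continuous_drag : Continuous drag := by
  unfold drag
  refine continuous_const.div (by fun_prop) fun p => by positivity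

theorem drag_abs (p : ℝ) : drag |p| = drag p := by simp [drag]

theorem drag_le_drag {p r : ℝ} (h : |p| ≤ |r|) : drag r ≤ drag p := by
  unfold drag
  have := sq_le_sq.2 h
  gcongr

theorem drag_lt_drag {p r : ℝ} (h : |p| < |r|) : drag r < drag p := by
  unfold drag
  have := sq_lt_sq.2 h
  gcongr

theorem abs_eq_of_drag_eq {p r : ℝ} (h : drag p = drag r) : |p| = |r| := by
  rcases lt_trichotomy |p| |r| with h' | h' | h'
  · exact absurd h (drag_lt_drag h').ne'
  · exact h'
  · exact absurd h (drag_lt_drag h').ne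

theorem drag_sub_tangent (m p : ℝ) : drag p - (tangentIntercept m - tangentDecay m * p) =
    (p - m) ^ 2 * (m ^ 2 - 1 + 2 * m * p) / ((1 + m ^ 2) ^ 2 * (1 + p ^ 2)) := by
  unfold drag tangentIntercept tangentDecay
  have h1 : (1 + m ^ 2) ≠ 0 := by positivity
  have h2 : (1 + p ^ 2) ≠ 0 := by positivity
  field_simp
  ring

/-- The difference has the double root `m` and a remaining factor `m ^ 2 - 1 + 2 * m * |p|`,
nonnegative exactly because `m ≥ 1`. -/
theorem tangent_le_drag {m : ℝ} (hm : 1 ≤ m) (p : ℝ) :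
    tangentIntercept m - tangentDecay m * |p| ≤ drag p := by
  rw [← drag_abs p, ← sub_nonneg, drag_sub_tangent]
  have := abs_nonneg p
  have h2 : 0 ≤ m ^ 2 - 1 + 2 * m * |p| := by nlinarith [mul_nonneg (by linarith : 0 ≤ m) this]
  positivity

/-- For `m = 1` the tangent line also meets the graph at slope 0; this is why flat parts appear when
`q = 0`. -/
theorem drag_eq_tangent {m : ℝ} (hm : 1 ≤ m) {p : ℝ}
    (h : drag p = tangentIntercept m - tangentDecay m * |p|) :
    |p| = m ∨ m = 1 ∧ p = 0 := by
  rw [← drag_abs p, ← sub_eq_zero, drag_sub_tangent, div_eq_zero_iff] at h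
  have h0 := abs_nonneg p
  rcases h with h | h
  · rcases mul_eq_zero.1 h with h | h
    · left; nlinarith [pow_eq_zero_iff (two_ne_zero) |>.1 h]
    · right
      have h3 := mul_nonneg (by linarith : 0 ≤ m) h0
      have h4 : m = 1 := by nlinarith
      refine ⟨h4, ?_⟩
      subst h4
      exact abs_eq_zero.1 (by linarith)
  · exact absurd h (by positivity)

theorem tangentDecay_pos {m : ℝ} (hm : 0 < m) : 0 < tangentDecay m := by
  unfold tangentDecay; positivity

/-- The tangent line decreases from its intercept at 0 to `drag m` at `m`. Applied at a stationary
`γ`, this shows that the edge of the parabola is less steep than the sides. -/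
theorem lt_of_tangentIntercept_eq {m p : ℝ} (hm : 0 < m) (h : drag p = tangentIntercept m) :
    |p| < m := by
  have h1 : drag m < drag p := by
    rw [h]
    have := drag_sub_tangent m m
    have := mul_pos (tangentDecay_pos hm) hm
    simp at *
    linarith
  by_contra h2
  rw [not_lt, ← abs_of_pos hm] at h2
  exact absurd (drag_le_drag h2) (not_le.2 (by simpa using h1))

/-! ### Resistance of a parabolic valley -/

/-- The resistance of the right half of a parabolic valley of half-width `s`. -/
noncomputable def valleyDrag (q s : ℝ) : ℝ := ∫ t in (0 : ℝ)..s, drag (q * t)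

theorem continuous_drag_mul (q : ℝ) : Continuous fun t => drag (q * t) :=
  continuous_drag.comp (by fun_prop)

theorem hasDerivAt_valleyDrag (q s : ℝ) : HasDerivAt (valleyDrag q) (drag (q * s)) s :=
  intervalIntegral.integral_hasDerivAt_right ((continuous_drag_mul q).intervalIntegrable _ _)
    (continuous_drag_mul q).stronglyMeasurable.stronglyMeasurableAtFilter
    (continuous_drag_mul q).continuousAt

theorem valleyDrag_sub (q s t : ℝ) :
    valleyDrag q t - valleyDrag q s = ∫ x in s..t, drag (q * x) := by
  unfold valleyDrag
  rw [intervalIntegral.integral_interval_sub_left] <;>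
    exact (continuous_drag_mul q).intervalIntegrable _ _

theorem valleyDrag_sub_le {q s t : ℝ} (hq : 0 ≤ q) (hs : 0 ≤ s) (hst : s ≤ t) :
    valleyDrag q t - valleyDrag q s ≤ (t - s) * drag (q * s) := by
  rw [valleyDrag_sub, ← smul_eq_mul, ← intervalIntegral.integral_const]
  refine intervalIntegral.integral_mono_on hst ((continuous_drag_mul q).intervalIntegrable _ _)
    (by simp) fun x hx => drag_le_drag ?_
  rw [abs_of_nonneg (by positivity), abs_of_nonneg (mul_nonneg hq (hs.trans hx.1))]
  exact mul_le_mul_of_nonneg_left hx.1 hq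

theorem valleyDrag_sub_lt {q s t : ℝ} (hq : 0 < q) (hs : 0 ≤ s) (hst : s < t) :
    valleyDrag q t - valleyDrag q s < (t - s) * drag (q * s) := by
  rw [valleyDrag_sub, ← smul_eq_mul, ← intervalIntegral.integral_const]
  refine intervalIntegral.integral_lt_integral_of_continuousOn_of_le_of_exists_lt hst
    (continuous_drag_mul q).continuousOn continuousOn_const ?_ ⟨t, ⟨hst.le, le_rfl⟩, ?_⟩
  · intro x hx
    refine drag_le_drag ?_
    rw [abs_of_nonneg (by positivity), abs_of_nonneg (mul_nonneg hq.le (hs.trans hx.1.le))]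
    exact mul_le_mul_of_nonneg_left hx.1.le hq.le
  · refine drag_lt_drag ?_
    rw [abs_of_nonneg (by positivity), abs_of_nonneg (mul_nonneg hq.le (hs.trans hst.le))]
    exact mul_lt_mul_of_pos_left hst hq

theorem valleyDrag_eq_of_pos {q : ℝ} (hq : 0 < q) (s : ℝ) :
    valleyDrag q s = 1 / q * Real.arctan (q * s) := by
  have h : ∀ x, HasDerivAt (fun x => 1 / q * Real.arctan (q * x)) (drag (q * x)) x := by
    intro x
    have h1 : HasDerivAt (fun x => q * x) q x := by simpa using (hasDerivAt_id x).const_mul q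
    convert! (h1.arctan.const_mul (1 / q)) using 1
    unfold drag
    field_simp
  unfold valleyDrag
  rw [intervalIntegral.integral_eq_sub_of_hasDerivAt (fun x _ => h x)
    ((continuous_drag_mul q).intervalIntegrable _ _)]
  simp

theorem valleyDrag_zero_left (s : ℝ) : valleyDrag 0 s = s := by simp [valleyDrag, drag]

/-! ### The reduced resistance and its minimizer -/

theorem reducedResistance_eq {M q : ℝ} (hq : 0 ≤ q) (γ : ℝ) :
    reducedResistance M q γ =
      2 * valleyDrag q γ + 2 * (1 - γ) ^ 3 / (M ^ 2 + (1 - γ) ^ 2) := by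
  unfold reducedResistance
  split_ifs with h
  · rw [valleyDrag_eq_of_pos h]; ring
  · obtain rfl : q = 0 := le_antisymm (not_lt.1 h) hq
    rw [valleyDrag_zero_left]

/-- At its point of contact `m = M / (1 - γ)` the tangent line equals the pressure, and `(1 - γ) * m
= M`. This is the form in which the lower bound arises. -/
theorem reducedResistance_eq_tangent {M q γ : ℝ} (hM : 0 < M) (hq : 0 ≤ q) (hγ : γ < 1) :
    reducedResistance M q γ = 2 * valleyDrag q γ + 2 * (1 - γ) * tangentIntercept (M / (1 - γ))
      - 2 * tangentDecay (M / (1 - γ)) * M := by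
  rw [reducedResistance_eq hq, add_sub_assoc]
  have h1 : 0 < 1 - γ := by linarith
  congr 1
  unfold tangentIntercept tangentDecay
  have : M ^ 2 + (1 - γ) ^ 2 ≠ 0 := by positivity
  have : (1 - γ) ^ 2 + M ^ 2 ≠ 0 := by positivity
  generalize 1 - γ = s at *
  field_simp
  ring

theorem tangentIntercept_one : tangentIntercept 1 = 1 := by norm_num [tangentIntercept]

theorem tangentDecay_one : tangentDecay 1 = 1 / 2 := by norm_num [tangentDecay]

/-- The factor of the derivative of `reducedResistance M q` that decides its sign, as a function
of `s = 1 - γ`. -/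
noncomputable def slopeSign (M q s : ℝ) : ℝ :=
  M ^ 2 * (M ^ 2 - s ^ 2) / (s ^ 2 + 3 * M ^ 2) - q ^ 2 * (s * (1 - s)) ^ 2

theorem hasDerivAt_reducedResistance {M q : ℝ} (hM : 0 < M) (hq : 0 ≤ q) (γ : ℝ) :
    HasDerivAt (reducedResistance M q)
      (2 * ((1 - γ) ^ 2 + 3 * M ^ 2) /
        ((1 + (q * γ) ^ 2) * (M ^ 2 + (1 - γ) ^ 2) ^ 2) * slopeSign M q (1 - γ)) γ := by
  rw [funext (reducedResistance_eq (M := M) hq)]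
  have h1 : HasDerivAt (fun γ : ℝ => 1 - γ) (-1) γ := by
    simpa using (hasDerivAt_id γ).const_sub 1
  have h2 := (((h1.fun_pow 3).const_mul 2).fun_div ((h1.fun_pow 2).const_add (M ^ 2))
    (by positivity))
  convert! ((hasDerivAt_valleyDrag q γ).const_mul 2).add h2 using 1
  unfold slopeSign drag
  have h3 : M ^ 2 + (1 - γ) ^ 2 ≠ 0 := by positivity
  have h4 : (1 - γ) ^ 2 + 3 * M ^ 2 ≠ 0 := by positivity
  have h5 : 1 + (q * γ) ^ 2 ≠ 0 := by positivity
  obtain ⟨s, rfl⟩ : ∃ s, γ = 1 - s := ⟨1 - γ, by ring⟩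
  simp only [sub_sub_cancel] at *
  field_simp
  ring

theorem hasDerivAt_slopeSign {M : ℝ} (hM : 0 < M) (q s : ℝ) :
    HasDerivAt (slopeSign M q) (-(8 * M ^ 4 * s / (s ^ 2 + 3 * M ^ 2) ^ 2)
      - 2 * q ^ 2 * s * ((1 - s) * (1 - 2 * s))) s := by
  have h1 := hasDerivAt_id' s
  have h2 := (((h1.fun_pow 2).const_sub (M ^ 2)).const_mul (M ^ 2)).fun_div
    ((h1.fun_pow 2).add_const (3 * M ^ 2)) (by positivity)
  have h3 := ((h1.fun_mul (h1.const_sub 1)).fun_pow 2).const_mul (q ^ 2)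
  convert! h2.sub h3 using 1
  have h4 : s ^ 2 + 3 * M ^ 2 ≠ 0 := by positivity
  field_simp
  ring

/-- The quotient contributes at most `-s / 2` to the derivative, since `s ^ 2 + 3 * M ^ 2 ≤ 4 * M ^
2`. The other term contributes at most `s / 4`, because `(1 - s) * (1 - 2 * s)` has minimum `-1 /
8`, at `s = 3 / 4`, and `q ≤ 1`. -/
theorem strictAntiOn_slopeSign {M q : ℝ} (hM : 0 < M) (hq : q ∈ Icc (0 : ℝ) 1) :
    StrictAntiOn (slopeSign M q) (Icc 0 M) := by
  refine strictAntiOn_of_deriv_neg (convex_Icc _ _)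
    (fun s _ => (hasDerivAt_slopeSign hM q s).continuousAt.continuousWithinAt) fun s hs => ?_
  rw [interior_Icc] at hs
  rw [(hasDerivAt_slopeSign hM q s).deriv]
  obtain ⟨h0, h1⟩ := hs
  have h2 : s / 2 ≤ 8 * M ^ 4 * s / (s ^ 2 + 3 * M ^ 2) ^ 2 := by
    rw [div_le_div_iff₀ (by positivity) (by positivity)]
    have : s ^ 2 + 3 * M ^ 2 ≤ 4 * M ^ 2 := by nlinarith
    have := pow_le_pow_left₀ (by positivity) this 2
    nlinarith
  have h3 : q ^ 2 ≤ 1 := by nlinarith [hq.1, hq.2]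
  have h4 : -(1 / 8) ≤ (1 - s) * (1 - 2 * s) := by nlinarith [sq_nonneg (s - 3 / 4)]
  have h5 : -(1 / 8) ≤ q ^ 2 * ((1 - s) * (1 - 2 * s)) := by
    rcases le_total 0 ((1 - s) * (1 - 2 * s)) with h | h
    · nlinarith [mul_nonneg (sq_nonneg q) h]
    · nlinarith
  nlinarith

theorem reducedResistance_deriv_pos {M q γ : ℝ} (hM : 0 < M) (hq : 0 ≤ q)
    (h : 0 < slopeSign M q (1 - γ)) : 0 < deriv (reducedResistance M q) γ := by
  rw [(hasDerivAt_reducedResistance hM hq γ).deriv]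
  positivity

theorem reducedResistance_deriv_neg {M q γ : ℝ} (hM : 0 < M) (hq : 0 ≤ q)
    (h : slopeSign M q (1 - γ) < 0) : deriv (reducedResistance M q) γ < 0 := by
  rw [(hasDerivAt_reducedResistance hM hq γ).deriv]
  exact mul_neg_of_pos_of_neg (by positivity) h

theorem continuous_reducedResistance {M q : ℝ} (hM : 0 < M) (hq : 0 ≤ q) :
    Continuous (reducedResistance M q) :=
  continuous_iff_continuousAt.2 fun γ => (hasDerivAt_reducedResistance hM hq γ).continuousAt

theorem reducedResistance_zero_lt {M q : ℝ} (hM : 1 ≤ M) (hq : q ∈ Icc (0 : ℝ) 1) {γ : ℝ}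
    (hγ : γ ∈ Ioc (0 : ℝ) 1) : reducedResistance M q 0 < reducedResistance M q γ := by
  have hM0 : 0 < M := by linarith
  refine strictMonoOn_of_deriv_pos (convex_Icc 0 1)
    (continuous_reducedResistance hM0 hq.1).continuousOn (fun x hx => ?_)
    ⟨le_rfl, zero_le_one⟩ ⟨hγ.1.le, hγ.2⟩ hγ.1
  rw [interior_Icc] at hx
  refine reducedResistance_deriv_pos hM0 hq.1 ?_
  have h1 := strictAntiOn_slopeSign hM0 hq (a := 1 - x) (b := 1)
    ⟨by linarith [hx.2], by linarith [hx.1]⟩ ⟨by linarith, hM⟩ (by linarith [hx.1])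
  have h2 : 0 ≤ slopeSign M q 1 := by
    unfold slopeSign
    have : 0 ≤ M ^ 2 - 1 ^ 2 := by nlinarith
    simp only [sub_self, mul_zero, ne_eq, OfNat.ofNat_ne_zero, not_false_eq_true, zero_pow,
      sub_zero]
    positivity
  linarith

/-- This is stationarity of the tangent form of the reduced resistance: tangent lines form an
envelope, so varying `m` contributes nothing to first order. -/
theorem drag_eq_tangentIntercept {M q γ : ℝ} (hM : 0 < M) (hγ : γ < 1)
    (h : slopeSign M q (1 - γ) = 0) : drag (q * γ) = tangentIntercept (M / (1 - γ)) := by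
  have h1 : 0 < 1 - γ := by linarith
  unfold slopeSign at h
  unfold drag tangentIntercept
  obtain ⟨s, rfl⟩ : ∃ s, γ = 1 - s := ⟨1 - γ, by ring⟩
  simp only [sub_sub_cancel] at *
  have h3 : s ^ 2 + 3 * M ^ 2 ≠ 0 := by positivity
  have h4 : 1 + (q * (1 - s)) ^ 2 ≠ 0 := by positivity
  field_simp at h ⊢
  linear_combination h

theorem exists_minimizer_reducedResistance {M q : ℝ} (hM : 0 < M) (hM1 : M < 1)
    (hq : q ∈ Icc (0 : ℝ) 1) :
    ∃ γ ∈ Ioo (0 : ℝ) 1, 1 - M ≤ γ ∧ (0 < q → 1 - M < γ) ∧ (q = 0 → γ = 1 - M) ∧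
      drag (q * γ) = tangentIntercept (M / (1 - γ)) ∧
      ∀ δ ∈ Icc (0 : ℝ) 1, δ ≠ γ → reducedResistance M q γ < reducedResistance M q δ := by
  have hc : ContinuousOn (slopeSign M q) (Icc 0 M) :=
    fun s _ => (hasDerivAt_slopeSign hM q s).continuousAt.continuousWithinAt
  have h0 : 0 < slopeSign M q 0 := by
    unfold slopeSign
    simp only [ne_eq, OfNat.ofNat_ne_zero, not_false_eq_true, zero_pow, sub_zero, mul_one,
      mul_zero, zero_add]
    positivity
  have hMM : slopeSign M q M = -(q ^ 2 * (M * (1 - M)) ^ 2) := by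
    unfold slopeSign; simp
  have hM' : slopeSign M q M ≤ 0 := by
    rw [hMM, neg_nonpos]; positivity
  obtain ⟨s, hs, hs0⟩ := intermediate_value_Icc' hM.le hc ⟨hM', h0.le⟩
  have hs_pos : 0 < s := by
    rcases hs.1.eq_or_lt with rfl | h
    · exact absurd hs0 h0.ne'
    · exact h
  have anti := strictAntiOn_slopeSign hM hq
  have hlt : ∀ γ ∈ Ioo 0 (1 - s), slopeSign M q (1 - γ) < 0 := by
    intro γ hγ
    rcases le_or_gt (1 - γ) M with h | h
    · rw [← hs0]
      exact anti hs ⟨by linarith [hγ.2], h⟩ (by linarith [hγ.2])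
    -- Beyond `M` monotonicity is not available, but both terms of `slopeSign` already have the
    -- right sign.
    · unfold slopeSign
      have h1 : M ^ 2 * (M ^ 2 - (1 - γ) ^ 2) / ((1 - γ) ^ 2 + 3 * M ^ 2) < 0 := by
        refine div_neg_of_neg_of_pos (mul_neg_of_pos_of_neg (by positivity) ?_) (by positivity)
        nlinarith
      have h2 : 0 ≤ q ^ 2 * ((1 - γ) * (1 - (1 - γ))) ^ 2 := by positivity
      linarith
  have hgt : ∀ γ ∈ Ioo (1 - s) 1, 0 < slopeSign M q (1 - γ) := by
    intro γ hγ
    rw [← hs0]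
    exact anti ⟨by linarith [hγ.2], by linarith [hγ.1, hs.2]⟩ hs (by linarith [hγ.1])
  have hanti : StrictAntiOn (reducedResistance M q) (Icc 0 (1 - s)) := by
    refine strictAntiOn_of_deriv_neg (convex_Icc _ _)
      (continuous_reducedResistance hM hq.1).continuousOn fun x hx => ?_
    rw [interior_Icc] at hx
    exact reducedResistance_deriv_neg hM hq.1 (hlt x hx)
  have hmono : StrictMonoOn (reducedResistance M q) (Icc (1 - s) 1) := by
    refine strictMonoOn_of_deriv_pos (convex_Icc _ _)
      (continuous_reducedResistance hM hq.1).continuousOn fun x hx => ?_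
    rw [interior_Icc] at hx
    exact reducedResistance_deriv_pos hM hq.1 (hgt x hx)
  have hs1 : s < 1 := hs.2.trans_lt hM1
  refine ⟨1 - s, ⟨by linarith, by linarith⟩, by linarith [hs.2], ?_, ?_, ?_, ?_⟩
  · intro hq0
    have : s ≠ M := by
      rintro rfl
      rw [hMM] at hs0
      have : 0 < q ^ 2 * (s * (1 - s)) ^ 2 := by
        have : 0 < 1 - s := by linarith
        positivity
      linarith
    linarith [lt_of_le_of_ne hs.2 this]
  · rintro rfl
    have : s = M := by
      by_contra h
      have h1 := anti hs ⟨hM.le, le_rfl⟩ (lt_of_le_of_ne hs.2 h)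
      rw [hMM, hs0] at h1
      simp at h1
    rw [this]
  · exact drag_eq_tangentIntercept hM (by linarith) (by simpa using hs0)
  · intro δ hδ hne
    rcases lt_or_gt_of_ne hne with h | h
    · exact hanti ⟨hδ.1, h.le⟩ ⟨by linarith, le_rfl⟩ h
    · exact hmono ⟨le_rfl, by linarith⟩ ⟨h.le, hδ.2⟩ h

/-! ### Regularity and one-sided bounds for `q`-concave functions -/

namespace QConcaveOn

variable {q : ℝ} {u : ℝ → ℝ}

theorem comp_neg (h : QConcaveOn q (Icc (-1) 1) u) :
    QConcaveOn q (Icc (-1) 1) (fun x => u (-x)) := by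
  refine ⟨h.1, fun x hx y hy a b ha hb hab => ?_⟩
  have := h.2 (x := -x) ⟨by linarith [hx.2], by linarith [hx.1]⟩ (y := -y)
    ⟨by linarith [hy.2], by linarith [hy.1]⟩ ha hb hab
  simp only [smul_eq_mul] at this ⊢
  convert! this using 2
  · ring
  · ring
  · ring_nf
  · ring

theorem exists_supergradient (h : QConcaveOn q (Icc (-1) 1) u) {x : ℝ}
    (hx : x ∈ Ioo (-1 : ℝ) 1) :
    ∃ p, ∀ y ∈ Icc (-1 : ℝ) 1, u y ≤ u x + p * (y - x) + q / 2 * (y - x) ^ 2 := by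
  have hc := ConcaveOn.neg h
  have hxi : x ∈ interior (Icc (-1 : ℝ) 1) := by rwa [interior_Icc]
  set f : ℝ → ℝ := -fun x => u x - q / 2 * x ^ 2 with hf
  have hf' : ∀ y, f y = q / 2 * y ^ 2 - u y := fun y => by simp [hf]
  refine ⟨q * x - derivWithin f (Ioi x) x, fun y hy => ?_⟩
  have key : f x + derivWithin f (Ioi x) x * (y - x) ≤ f y := by
    rcases lt_trichotomy x y with hxy | rfl | hxy
    · have := hc.rightDeriv_le_slope_of_mem_interior hxi hy hxy
      rw [slope_def_field, le_div_iff₀ (by linarith)] at this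
      linarith
    · simp
    · have h1 := hc.slope_le_leftDeriv_of_mem_interior hy hxi hxy
      have h2 := h1.trans (hc.leftDeriv_le_rightDeriv_of_mem_interior hxi)
      rw [slope_def_field, div_le_iff₀ (by linarith)] at h2
      linarith
  rw [hf', hf'] at key
  nlinarith

/-- The difference between the supporting parabola and `u` has a minimum at `x`, which identifies
the supergradient with the derivative. -/
theorem le_quadratic (h : QConcaveOn q (Icc (-1) 1) u) {x y : ℝ} (hx : x ∈ Ioo (-1 : ℝ) 1)
    (hd : DifferentiableAt ℝ u x) (hy : y ∈ Icc (-1 : ℝ) 1) :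
    u y ≤ u x + deriv u x * (y - x) + q / 2 * (y - x) ^ 2 := by
  obtain ⟨p, hp⟩ := h.exists_supergradient hx
  suffices p = deriv u x by rw [← this]; exact hp y hy
  have h1 : HasDerivAt (fun y => u x + p * (y - x) + q / 2 * (y - x) ^ 2 - u y)
      (p - deriv u x) x := by
    have h2 : HasDerivAt (fun y => y - x) 1 x := (hasDerivAt_id' x).sub_const x
    convert! (((h2.const_mul p).const_add (u x)).add ((h2.fun_pow 2).const_mul (q / 2))).sub
      hd.hasDerivAt using 1
    simp
  have h3 : IsLocalMin (fun y => u x + p * (y - x) + q / 2 * (y - x) ^ 2 - u y) x := by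
    filter_upwards [Icc_mem_nhds hx.1 hx.2] with y hy
    have := hp y hy
    simp only [sub_self, mul_zero, add_zero, ne_eq, OfNat.ofNat_ne_zero, not_false_eq_true,
      zero_pow]
    linarith
  have := h3.hasDerivAt_eq_zero h1
  linarith

theorem continuousOn_Ioo (h : QConcaveOn q (Icc (-1) 1) u) : ContinuousOn u (Ioo (-1) 1) := by
  have h1 : ContinuousOn (fun x => u x - q / 2 * x ^ 2) (Ioo (-1) 1) :=
    (ConcaveOn.subset h Ioo_subset_Icc_self (convex_Ioo _ _)).continuousOn isOpen_Ioo
  have h2 : ContinuousOn (fun x : ℝ => q / 2 * x ^ 2) (Ioo (-1) 1) := by fun_prop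
  exact (h1.add h2).congr fun x _ => by simp

/-- The concave function `u - q / 2 * x ^ 2` increases up to a maximum point and decreases after it,
so differentiability of monotone functions applies. -/
theorem ae_differentiableAt (h : QConcaveOn q (Icc (-1) 1) u)
    (hu : ContinuousOn u (Icc (-1) 1)) :
    ∀ᵐ x, x ∈ Ioo (-1 : ℝ) 1 → DifferentiableAt ℝ u x := by
  set v : ℝ → ℝ := fun x => u x - q / 2 * x ^ 2 with hv
  have hvc : ContinuousOn v (Icc (-1) 1) := hu.sub (by fun_prop)
  obtain ⟨c, hc, hmax⟩ := isCompact_Icc.exists_isMaxOn ⟨(0 : ℝ), by norm_num, by norm_num⟩ hvc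
  have hmono : MonotoneOn v (Icc (-1) c) := fun x hx y hy hxy => by
    have := h.min_le_of_mem_Icc (x := x) (y := c) (z := y) ⟨hx.1, hx.2.trans hc.2⟩ hc ⟨hxy, hy.2⟩
    rwa [min_eq_left (hmax ⟨hx.1, hx.2.trans hc.2⟩)] at this
  have hanti : MonotoneOn (fun x => -v x) (Icc c 1) := fun x hx y hy hxy => by
    have := h.min_le_of_mem_Icc (x := c) (y := y) (z := x) hc ⟨hc.1.trans hy.1, hy.2⟩ ⟨hx.1, hxy⟩
    rw [min_eq_right (hmax ⟨hc.1.trans hy.1, hy.2⟩)] at this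
    exact neg_le_neg this
  have hne : ∀ᵐ x : ℝ, x ≠ c := by simp [ae_iff, measure_singleton]
  filter_upwards [hmono.ae_differentiableWithinAt_of_mem,
    hanti.ae_differentiableWithinAt_of_mem, hne] with x h1 h2 hxc hx
  have hd : DifferentiableAt ℝ v x := by
    rcases lt_or_gt_of_ne hxc with hlt | hlt
    · exact (h1 ⟨hx.1.le, hlt.le⟩).differentiableAt (Icc_mem_nhds hx.1 hlt)
    · simpa using ((h2 ⟨hlt.le, hx.2.le⟩).differentiableAt (Icc_mem_nhds hlt hx.2)).neg
  have hd2 : DifferentiableAt ℝ (fun x : ℝ => q / 2 * x ^ 2) x := by fun_prop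
  have := hd.add hd2
  refine this.congr_of_eventuallyEq (Eventually.of_forall fun y => ?_)
  simp [hv]

end QConcaveOn

/-- Over `n + 1` equal steps the errors add up to `C * (b - a) ^ 2 / (n + 1)`, which tends to 0. -/
theorem le_of_sub_le_mul_sq {f : ℝ → ℝ} {a b C : ℝ} (hab : a ≤ b)
    (h : ∀ x ∈ Icc a b, ∀ y ∈ Icc a b, x ≤ y → f y - f x ≤ C * (y - x) ^ 2) : f b ≤ f a := by
  have key : ∀ n : ℕ, f b - f a ≤ C * (b - a) ^ 2 / (n + 1) := by
    intro n
    have hn : (0 : ℝ) < n + 1 := by positivity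
    have step : ∀ i : ℕ, i ≤ n + 1 → f (a + i * ((b - a) / (n + 1))) - f a ≤
        i * (C * ((b - a) / (n + 1)) ^ 2) := by
      intro i
      induction i with
      | zero => intro _; simp
      | succ i ih =>
        intro hi
        have hd : 0 ≤ (b - a) / (n + 1) := div_nonneg (by linarith) hn.le
        have hmem : ∀ j : ℕ, j ≤ n + 1 → a + j * ((b - a) / (n + 1)) ∈ Icc a b := by
          intro j hj
          have hj' : (j : ℝ) ≤ n + 1 := by exact_mod_cast hj
          refine ⟨by nlinarith [mul_nonneg (Nat.cast_nonneg (α := ℝ) j) hd], ?_⟩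
          have := mul_le_mul_of_nonneg_right hj' hd
          rw [mul_div_cancel₀ _ hn.ne'] at this
          linarith
        have h1 := h _ (hmem i (by omega)) _ (hmem (i + 1) hi) (by push_cast; nlinarith)
        have h2 := ih (by omega)
        have h3 : a + ((i + 1 : ℕ) : ℝ) * ((b - a) / (n + 1)) - (a + i * ((b - a) / (n + 1))) =
            (b - a) / (n + 1) := by push_cast; ring
        rw [h3] at h1
        push_cast at h1 ⊢
        linarith
    have := step (n + 1) le_rfl
    push_cast at this
    rw [mul_div_cancel₀ _ hn.ne'] at this
    calc f b - f a = f (a + (b - a)) - f a := by ring_nf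
      _ ≤ _ := this
      _ = _ := by field_simp
  have hlim : Tendsto (fun n : ℕ => C * (b - a) ^ 2 / ((n : ℝ) + 1)) atTop (𝓝 0) := by
    have := (tendsto_one_div_add_atTop_nhds_zero_nat (𝕜 := ℝ)).const_mul (C * (b - a) ^ 2)
    simpa [div_eq_mul_inv] using this
  have := ge_of_tendsto' hlim key
  linarith

theorem Ioo_subset_closure_of_ae {P : ℝ → Prop} {a b : ℝ} (h : ∀ᵐ x, x ∈ Ioo a b → P x) :
    Ioo a b ⊆ closure {x ∈ Ioo a b | P x} := by
  refine ((Measure.dense_of_ae h).open_subset_closure_inter isOpen_Ioo).trans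
    (closure_mono fun x hx => ⟨hx.1, hx.2 hx.1⟩)

theorem forall_mem_Icc_le_of_ae {f g : ℝ → ℝ} {a b : ℝ} (hab : a < b)
    (hf : ContinuousOn f (Icc a b)) (hg : ContinuousOn g (Icc a b))
    (h : ∀ᵐ x, x ∈ Ioo a b → f x ≤ g x) : ∀ x ∈ Icc a b, f x ≤ g x := by
  have hcl : closure {x ∈ Ioo a b | f x ≤ g x} = Icc a b := by
    refine Subset.antisymm ?_ ?_
    · exact (closure_mono (sep_subset _ _)).trans (closure_Ioo hab.ne).le
    · rw [← closure_Ioo hab.ne]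
      exact closure_minimal (Ioo_subset_closure_of_ae h) isClosed_closure
  intro x hx
  rw [← hcl] at hx
  exact le_on_closure (fun x hx => hx.2) (by rwa [hcl]) (by rwa [hcl]) hx

namespace QConcaveOn

variable {q : ℝ} {u : ℝ → ℝ}

/-- Absolute continuity is bypassed: the supporting parabola at almost every `x` in `(y, z)`, with
`x` tending to `y`, bounds each increment by `c * (z - y)` up to a quadratic error, which
subdivision removes. -/
theorem sub_le_of_deriv_le (h : QConcaveOn q (Icc (-1) 1) u) (hu : ContinuousOn u (Icc (-1) 1))
    {a b c : ℝ} (ha : -1 ≤ a) (hab : a ≤ b) (hb : b ≤ 1)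
    (hd : ∀ᵐ x, x ∈ Ioo a b → deriv u x ≤ c) : u b - u a ≤ c * (b - a) := by
  suffices (fun x => u x - c * x) b ≤ (fun x => u x - c * x) a by
    simp only at this; linarith
  refine le_of_sub_le_mul_sq (f := fun x => u x - c * x) (C := q / 2) hab fun y hy z hz hyz => ?_
  rcases hyz.eq_or_lt with rfl | hyz
  · simp
  have hsub : Icc y z ⊆ Icc (-1) 1 := Icc_subset_Icc (ha.trans hy.1) (hz.2.trans hb)
  have := forall_mem_Icc_le_of_ae (f := fun _ => u z)
    (g := fun x => u x + c * (z - x) + q / 2 * (z - x) ^ 2) hyz continuousOn_const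
    (((hu.mono hsub).add (by fun_prop)).add (by fun_prop)) (by
      filter_upwards [hd, h.ae_differentiableAt hu] with x hx1 hx2 hx
      have hx3 : x ∈ Ioo (-1 : ℝ) 1 :=
        ⟨(ha.trans hy.1).trans_lt hx.1, hx.2.trans_le (hz.2.trans hb)⟩
      have h1 := h.le_quadratic hx3 (hx2 hx3) (hsub (right_mem_Icc.2 hyz.le))
      have h2 := hx1 ⟨hy.1.trans_lt hx.1, hx.2.trans_le hz.2⟩
      have h3 := mul_le_mul_of_nonneg_right h2 (by linarith [hx.2] : 0 ≤ z - x)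
      linarith) y (left_mem_Icc.2 hyz.le)
  linarith

theorem le_sub_of_le_deriv (h : QConcaveOn q (Icc (-1) 1) u) (hu : ContinuousOn u (Icc (-1) 1))
    {a b c : ℝ} (ha : -1 ≤ a) (hab : a ≤ b) (hb : b ≤ 1)
    (hd : ∀ᵐ x, x ∈ Ioo a b → c ≤ deriv u x) : c * (b - a) ≤ u b - u a := by
  have hd' : ∀ᵐ x, x ∈ Ioo (-b) (-a) → deriv (fun x => u (-x)) x ≤ -c := by
    have := (Measure.measurePreserving_neg (volume : Measure ℝ)).quasiMeasurePreserving.ae hd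
    filter_upwards [this] with x hx hx2
    rw [deriv_comp_neg]
    exact neg_le_neg (hx ⟨by linarith [hx2.2], by linarith [hx2.1]⟩)
  have hu' : ContinuousOn (fun x => u (-x)) (Icc (-1) 1) :=
    hu.comp continuousOn_neg fun x hx => ⟨by linarith [hx.2], by linarith [hx.1]⟩
  have := h.comp_neg.sub_le_of_deriv_le hu' (a := -b) (b := -a) (by linarith) (by linarith)
    (by linarith) hd'
  simp only [neg_neg] at this
  linarith

/-- The slope from 0 is antitone and bounded below by its value at 1, so it converges at 1. -/
theorem exists_tendsto_left (h : QConcaveOn q (Icc (-1) 1) u) :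
    ∃ l, Tendsto u (𝓝[<] 1) (𝓝 l) ∧ u 1 ≤ l := by
  set v : ℝ → ℝ := fun x => u x - q / 2 * x ^ 2 with hv
  have h0 : (0 : ℝ) ∈ Icc (-1 : ℝ) 1 := by norm_num
  have h1 : (1 : ℝ) ∈ Icc (-1 : ℝ) 1 := by norm_num
  have hanti := ConcaveOn.antitoneOn_slope_gt h h0
  have hle : ∀ x ∈ Ioo (0 : ℝ) 1, slope v 0 1 ≤ slope v 0 x := fun x hx =>
    hanti ⟨⟨by linarith [hx.1], hx.2.le⟩, hx.1⟩ ⟨h1, one_pos⟩ hx.2.le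
  have hanti' : AntitoneOn (slope v 0) (Ioo 0 1) :=
    hanti.mono fun x hx => ⟨⟨by linarith [hx.1], hx.2.le⟩, hx.1⟩
  have hlim := hanti'.tendsto_nhdsWithin_Ioo_left (by norm_num)
    ⟨slope v 0 1, by rintro _ ⟨x, hx, rfl⟩; exact hle x hx⟩
  set L := sInf (slope v 0 '' Ioo 0 1)
  have hL : slope v 0 1 ≤ L := by
    refine le_csInf ((nonempty_Ioo.2 one_pos).image _) ?_
    rintro _ ⟨x, hx, rfl⟩; exact hle x hx
  have hid : Tendsto (fun x : ℝ => x) (𝓝[<] 1) (𝓝 1) := tendsto_nhdsWithin_of_tendsto_nhds tendsto_id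
  refine ⟨v 0 + 1 * L + q / 2 * 1 ^ 2, ?_, ?_⟩
  · have := ((hid.mul hlim).const_add (v 0)).add ((hid.pow 2).const_mul (q / 2))
    refine this.congr' ?_
    filter_upwards [Ioo_mem_nhdsLT one_pos] with x hx
    rw [slope_def_field]
    have := hx.1.ne'
    simp only [hv]
    field_simp
    ring
  · rw [slope_def_field] at hL
    simp only [hv] at hL ⊢
    norm_num at hL ⊢
    linarith

end QConcaveOn

/-! ### Continuity up to the endpoints -/

/-- A profile may jump downwards at an endpoint. Raising it to its limit leaves the resistance
unchanged and makes compactness arguments available. -/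
theorem exists_continuous_extension {M q : ℝ} {u : ℝ → ℝ} (hu : u ∈ admissibleProfiles M q) :
    ∃ v ∈ admissibleProfiles M q, ContinuousOn v (Icc (-1) 1) ∧ EqOn v u (Ioo (-1) 1) ∧
      ∀ x ∈ Icc (-1 : ℝ) 1, u x ≤ v x := by
  obtain ⟨hm, hq⟩ := hu
  obtain ⟨r, hr, hr1⟩ := hq.exists_tendsto_left
  obtain ⟨l, hl, hl1⟩ := hq.comp_neg.exists_tendsto_left
  have hl' : Tendsto u (𝓝[>] (-1)) (𝓝 l) := by
    have : Tendsto (fun x : ℝ => -x) (𝓝[>] (-1)) (𝓝[<] 1) := by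
      simpa using tendsto_neg_nhdsGT (a := (-1 : ℝ))
    simpa [Function.comp_def] using hl.comp this
  have hc := hq.continuousOn_Ioo
  have hne : (-1 : ℝ) ≠ 1 := by norm_num
  have hcl : closure (Ioo (-1 : ℝ) 1) = Icc (-1) 1 := closure_Ioo hne
  set v := extendFrom (Ioo (-1) 1) u with hv
  have hvc : ContinuousOn v (Icc (-1) 1) := continuousOn_Icc_extendFrom_Ioo hc hl' hr
  have heq : EqOn v u (Ioo (-1) 1) := extendFrom_extends hc
  refine ⟨v, ⟨?_, ?_⟩, hvc, heq, ?_⟩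
  · have : MapsTo v (Ioo (-1) 1) (Icc 0 M) := fun x hx => by
      rw [heq hx]; exact hm (Ioo_subset_Icc_self hx)
    have := this.closure_of_continuousOn (by rwa [hcl])
    rwa [hcl, isClosed_Icc.closure_eq] at this
  · refine ⟨convex_Icc _ _, fun x hx y hy a b ha hb hab => ?_⟩
    have hw : ContinuousOn (fun x => v x - q / 2 * x ^ 2) (Icc (-1) 1) := hvc.sub (by fun_prop)
    have hcl2 : closure (Ioo (-1 : ℝ) 1 ×ˢ Ioo (-1 : ℝ) 1) = Icc (-1) 1 ×ˢ Icc (-1) 1 := by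
      rw [closure_prod_eq, hcl]
    have := le_on_closure (s := Ioo (-1 : ℝ) 1 ×ˢ Ioo (-1 : ℝ) 1)
      (f := fun p : ℝ × ℝ => a • (v p.1 - q / 2 * p.1 ^ 2) + b • (v p.2 - q / 2 * p.2 ^ 2))
      (g := fun p : ℝ × ℝ => v (a • p.1 + b • p.2) - q / 2 * (a • p.1 + b • p.2) ^ 2)
      (fun p hp => by
        have hz := (convex_Ioo (-1 : ℝ) 1) hp.1 hp.2 ha hb hab
        rw [heq hp.1, heq hp.2, heq hz]
        exact hq.2 (Ioo_subset_Icc_self hp.1) (Ioo_subset_Icc_self hp.2) ha hb hab)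
      (by
        rw [hcl2]
        refine ContinuousOn.add ?_ ?_
        · exact (hw.comp continuousOn_fst fun p hp => hp.1).const_smul a
        · exact (hw.comp continuousOn_snd fun p hp => hp.2).const_smul b)
      (by
        rw [hcl2]
        exact hw.comp (by fun_prop) fun p hp => (convex_Icc (-1 : ℝ) 1) hp.1 hp.2 ha hb hab)
      (x := (x, y)) (by rw [hcl2]; exact ⟨hx, hy⟩)
    exact this
  · intro x hx
    rcases eq_endpoints_or_mem_Ioo_of_mem_Icc hx with rfl | rfl | h
    · rw [hv, eq_lim_at_left_extendFrom_Ioo (by norm_num) hl']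
      simpa using hl1
    · rw [hv, eq_lim_at_right_extendFrom_Ioo (by norm_num) hr]
      exact hr1
    · exact (heq h).ge

/-! ### Valleys and running maxima -/

/-- The points of `[-1, 1]` from which `u` is strictly higher somewhere on either side. -/
def valleys (u : ℝ → ℝ) : Set ℝ :=
  {y | ∃ x ∈ Icc (-1 : ℝ) 1, ∃ z ∈ Icc (-1 : ℝ) 1, x < y ∧ y < z ∧ u y < u x ∧ u y < u z}

theorem valleys_subset (u : ℝ → ℝ) : valleys u ⊆ Ioo (-1) 1 := by
  rintro y ⟨x, hx, z, hz, hxy, hyz, -⟩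
  exact ⟨hx.1.trans_lt hxy, hyz.trans_le hz.2⟩

theorem isOpen_valleys {u : ℝ → ℝ} (hu : ContinuousOn u (Icc (-1) 1)) : IsOpen (valleys u) := by
  rw [isOpen_iff_mem_nhds]
  intro y hy
  have hy' := valleys_subset u hy
  obtain ⟨x, hx, z, hz, hxy, hyz, h1, h2⟩ := hy
  have hc : ContinuousAt u y := hu.continuousAt (Icc_mem_nhds hy'.1 hy'.2)
  filter_upwards [lt_mem_nhds hxy, gt_mem_nhds hyz, hc.eventually_lt_const h1,
    hc.eventually_lt_const h2] with t h3 h4 h5 h6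
  exact ⟨x, hx, z, hz, h3, h4, h5, h6⟩

theorem valleys_eq_empty {u : ℝ → ℝ} (h : QConcaveOn 0 (Icc (-1) 1) u) : valleys u = ∅ := by
  rw [eq_empty_iff_forall_notMem]
  rintro y ⟨x, hx, z, hz, hxy, hyz, h1, h2⟩
  have := h.min_le_of_mem_Icc hx hz ⟨hxy.le, hyz.le⟩
  simp only [zero_div, zero_mul, sub_zero] at this
  exact absurd this (not_le.2 (lt_min h1 h2))

/-- The running maximum `U` is monotone, so its derivative is integrable with integral at most its
rise. At a record point `U - f` attains its minimum 0, so the two derivatives agree there. -/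
theorem exists_deriv_runningMax {f : ℝ → ℝ} {a b : ℝ} (hab : a ≤ b)
    (hmax : ∀ x ∈ Icc a b, f x ≤ f b) :
    ∃ ρ : ℝ → ℝ, IntervalIntegrable ρ volume a b ∧ (∀ x ∈ Ioo a b, 0 ≤ ρ x) ∧
      ∫ x in a..b, ρ x ≤ f b - f a ∧
      ∀ᵐ x, x ∈ Ioo a b → DifferentiableAt ℝ f x → (∀ y ∈ Icc a x, f y ≤ f x) →
        deriv f x = ρ x := by
  set U : ℝ → ℝ := fun x => sSup (f '' Icc a x) with hU
  have hbdd : ∀ x ≤ b, BddAbove (f '' Icc a x) := by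
    rintro x hx
    refine ⟨f b, ?_⟩
    rintro _ ⟨y, hy, rfl⟩
    exact hmax y ⟨hy.1, hy.2.trans hx⟩
  have hle : ∀ x ∈ Icc a b, f x ≤ U x := fun x hx =>
    le_csSup (hbdd x hx.2) ⟨x, ⟨hx.1, le_rfl⟩, rfl⟩
  have hge : ∀ x, a ≤ x → (∀ y ∈ Icc a x, f y ≤ f x) → U x ≤ f x := by
    intro x hx h
    refine csSup_le ⟨f x, x, ⟨hx, le_rfl⟩, rfl⟩ ?_
    rintro _ ⟨y, hy, rfl⟩
    exact h y hy
  have hmono : MonotoneOn U (Icc a b) := fun x hx y hy hxy =>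
    csSup_le_csSup (hbdd y hy.2) ⟨f x, x, ⟨hx.1, le_rfl⟩, rfl⟩
      (image_mono (Icc_subset_Icc_right hxy))
  have hUa : U a = f a := by simp [hU]
  have hUb : U b = f b := le_antisymm (hge b hab hmax) (hle b (right_mem_Icc.2 hab))
  have hmono' : MonotoneOn U (uIcc a b) := by rwa [uIcc_of_le hab]
  refine ⟨deriv U, hmono'.intervalIntegrable_deriv, fun x hx => ?_, ?_, ?_⟩
  · rw [← derivWithin_of_mem_nhds (Icc_mem_nhds hx.1 hx.2)]
    exact hmono.derivWithin_nonneg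
  · have := hmono'.intervalIntegral_deriv_mem_uIcc
    rw [hUa, hUb, uIcc_of_le (by linarith [hmax a (left_mem_Icc.2 hab)])] at this
    exact this.2
  · filter_upwards [hmono.ae_differentiableWithinAt_of_mem] with x hx hxab hd hrec
    have hdU : DifferentiableAt ℝ U x :=
      (hx (Ioo_subset_Icc_self hxab)).differentiableAt (Icc_mem_nhds hxab.1 hxab.2)
    have hmin : IsLocalMin (fun y => U y - f y) x := by
      filter_upwards [Icc_mem_nhds hxab.1 hxab.2] with y hy
      have h1 := hle y hy
      have h2 := hge x hxab.1.le hrec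
      linarith
    have := hmin.hasDerivAt_eq_zero (hdU.hasDerivAt.sub hd.hasDerivAt)
    linarith

theorem exists_descent {u : ℝ → ℝ} {c : ℝ}
    (hc : c ∈ Icc (-1 : ℝ) 1) (hmax : ∀ x ∈ Icc (-1 : ℝ) 1, u x ≤ u c) :
    ∃ ρ : ℝ → ℝ, IntervalIntegrable ρ volume (-1) 1 ∧ (∀ᵐ x, x ∈ Ioo (-1 : ℝ) 1 → 0 ≤ ρ x) ∧
      ∫ x in (-1)..1, ρ x ≤ (u c - u (-1)) + (u c - u 1) ∧
      ∀ᵐ x, x ∈ Ioo (-1 : ℝ) 1 → DifferentiableAt ℝ u x → x ∉ valleys u →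
        (x < c → deriv u x = ρ x) ∧ (c < x → deriv u x = -ρ x) := by
  obtain ⟨ρ₁, hi₁, hn₁, hI₁, hd₁⟩ := exists_deriv_runningMax hc.1
    fun x hx => hmax x ⟨hx.1, hx.2.trans hc.2⟩
  obtain ⟨ρ₂, hi₂, hn₂, hI₂, hd₂⟩ := exists_deriv_runningMax (f := fun x => u (-x))
    (neg_le_neg hc.2) fun x hx => by
      simp only [neg_neg]
      exact hmax _ ⟨by linarith [hx.2, hc.1], by linarith [hx.1]⟩
  have hi₂' : IntervalIntegrable (fun x => ρ₂ (-x)) volume c 1 := by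
    have := hi₂.comp_sub_left 0
    simp only [zero_sub, sub_neg_eq_add, zero_add] at this
    simpa using this.symm
  have heq₁ : EqOn (fun x => if x < c then ρ₁ x else ρ₂ (-x)) ρ₁ (Ioo (-1) c) := fun x hx => by
    simp [hx.2]
  have heq₂ : EqOn (fun x => if x < c then ρ₁ x else ρ₂ (-x)) (fun x => ρ₂ (-x)) (Ioo c 1) :=
    fun x hx => by simp [hx.1.le]
  have hj₁ : IntervalIntegrable (fun x => if x < c then ρ₁ x else ρ₂ (-x)) volume (-1) c := by
    rw [intervalIntegrable_iff_integrableOn_Ioo_of_le hc.1] at hi₁ ⊢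
    exact hi₁.congr_fun heq₁.symm measurableSet_Ioo
  have hj₂ : IntervalIntegrable (fun x => if x < c then ρ₁ x else ρ₂ (-x)) volume c 1 := by
    rw [intervalIntegrable_iff_integrableOn_Ioo_of_le hc.2] at hi₂' ⊢
    exact hi₂'.congr_fun heq₂.symm measurableSet_Ioo
  have hne : ∀ᵐ x : ℝ, x ≠ c := by simp [ae_iff, measure_singleton]
  refine ⟨fun x => if x < c then ρ₁ x else ρ₂ (-x), hj₁.trans hj₂, ?_, ?_, ?_⟩
  · filter_upwards [hne] with x hxc hx
    split_ifs with h
    · exact hn₁ x ⟨hx.1, h⟩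
    · exact hn₂ (-x) ⟨by linarith [hx.2], by linarith [lt_of_le_of_ne (not_lt.1 h) hxc.symm]⟩
  · rw [← intervalIntegral.integral_add_adjacent_intervals hj₁ hj₂]
    refine add_le_add ?_ ?_
    · refine le_trans (le_of_eq ?_) hI₁
      rw [intervalIntegral.integral_of_le hc.1, intervalIntegral.integral_of_le hc.1,
        integral_Ioc_eq_integral_Ioo, integral_Ioc_eq_integral_Ioo]
      exact setIntegral_congr_fun measurableSet_Ioo heq₁
    · simp only [neg_neg] at hI₂
      refine le_trans (le_of_eq ?_) hI₂
      rw [← intervalIntegral.integral_comp_neg, intervalIntegral.integral_of_le hc.2,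
        intervalIntegral.integral_of_le hc.2,
        integral_Ioc_eq_integral_Ioo, integral_Ioc_eq_integral_Ioo]
      exact setIntegral_congr_fun measurableSet_Ioo heq₂
  · have hd₂' := (Measure.measurePreserving_neg
      (volume : Measure ℝ)).quasiMeasurePreserving.ae hd₂
    filter_upwards [hd₁, hd₂'] with x h1 h2 hx hdx hv
    refine ⟨fun hxc => ?_, fun hxc => ?_⟩
    · simp only [hxc, if_true]
      refine h1 ⟨hx.1, hxc⟩ hdx fun y hy => ?_
      by_contra! hlt
      have hyx : y < x := lt_of_le_of_ne hy.2 (by rintro rfl; exact lt_irrefl _ hlt)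
      have hy' : y ∈ Icc (-1 : ℝ) 1 := ⟨hy.1, hy.2.trans hx.2.le⟩
      -- A higher point on the left, together with `c` on the right, would put `x` in a valley.
      exact hv ⟨y, hy', c, hc, hyx, hxc, hlt, hlt.trans_le (hmax y hy')⟩
    · simp only [hxc.le.not_gt, if_false]
      have hdx' : DifferentiableAt ℝ (fun x => u (-x)) (-x) := by
        have : DifferentiableAt ℝ u (-(-x)) := by rwa [neg_neg]
        exact this.comp (-x) differentiable_neg.differentiableAt
      rw [← h2 ⟨by linarith [hx.2], by linarith⟩ hdx' fun y hy => ?_, deriv_comp_neg, neg_neg,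
        neg_neg]
      simp only [neg_neg]
      by_contra! hlt
      have hyx : x < -y := by
        refine lt_of_le_of_ne (by linarith [hy.2]) ?_
        intro h
        rw [← h] at hlt
        exact lt_irrefl _ hlt
      have hy' : -y ∈ Icc (-1 : ℝ) 1 := ⟨by linarith [hx.1], by linarith [hy.1]⟩
      exact hv ⟨c, hc, -y, hy', hxc, hyx, hlt.trans_le (hmax _ hy'), hlt⟩

/-! ### The deepest valley -/

theorem QConcaveOn.exists_lower_point {q : ℝ} {u : ℝ → ℝ} (h : QConcaveOn q (Icc (-1) 1) u)
    (hq : 0 < q) {x y z : ℝ} (hx : x ∈ Icc (-1 : ℝ) 1) (hz : z ∈ Icc (-1 : ℝ) 1) (hxy : x < y)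
    (hyz : y < z) (hyx' : u y < u x) (hyz' : u y < u z) (hd : DifferentiableAt ℝ u y) :
    ∃ t ∈ Ioo x z, u t ≤ u y - deriv u y ^ 2 / (2 * q) := by
  have hy : y ∈ Ioo (-1 : ℝ) 1 := ⟨hx.1.trans_lt hxy, hyz.trans_le hz.2⟩
  have h1 := h.le_quadratic hy hd hx
  have h2 := h.le_quadratic hy hd hz
  set p := deriv u y
  have h3 : p < q * (y - x) := by
    by_contra! hc
    nlinarith [mul_pos hq (mul_pos (sub_pos.2 hxy) (sub_pos.2 hxy)),
      mul_le_mul_of_nonneg_right hc (sub_pos.2 hxy).le]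
  have h4 : -(q * (z - y)) < p := by
    by_contra! hc
    nlinarith [mul_pos hq (mul_pos (sub_pos.2 hyz) (sub_pos.2 hyz)),
      mul_le_mul_of_nonneg_right hc (sub_pos.2 hyz).le]
  have h5 : p / q < y - x := by rw [div_lt_iff₀ hq]; linarith
  have h6 : -(z - y) < p / q := by rw [lt_div_iff₀ hq]; linarith
  -- This is the vertex of the supporting parabola at `y`. It lies between `x` and `z` because that
  -- parabola exceeds `u y` at both.
  refine ⟨y - p / q, ⟨by linarith, by linarith⟩, ?_⟩
  have h7 := h.le_quadratic hy hd (y := y - p / q) ⟨by linarith [hx.1], by linarith [hz.2]⟩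
  refine h7.trans (le_of_eq ?_)
  change u y + p * (y - p / q - y) + q / 2 * (y - p / q - y) ^ 2 = _
  field_simp
  ring

/-- The centre `d` and the half-width `s` of the deepest valley of `u`. -/
structure IsDeepestValley (q : ℝ) (u : ℝ → ℝ) (d s : ℝ) : Prop where
  nonneg : 0 ≤ s
  subset : Ioo (d - s) (d + s) ⊆ valleys u
  le_parabola : 0 < s → ∀ y ∈ Icc (-1 : ℝ) 1, u y ≤ u d + q / 2 * (y - d) ^ 2
  abs_deriv_le : ∀ y ∈ valleys u, DifferentiableAt ℝ u y → |deriv u y| ≤ q * s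
  deriv_sq_le : ∀ y ∈ Ioo (d - s) (d + s), DifferentiableAt ℝ u y →
    deriv u y ^ 2 ≤ 2 * q * (u y - u d)

theorem IsDeepestValley.abs_deriv_le_mul_abs {q : ℝ} {u : ℝ → ℝ} {d s : ℝ} (hq : 0 ≤ q)
    (h : IsDeepestValley q u d s) {y : ℝ} (hy : y ∈ Ioo (d - s) (d + s))
    (hd : DifferentiableAt ℝ u y) : |deriv u y| ≤ q * |y - d| := by
  have hs : 0 < s := by linarith [hy.1, hy.2]
  have h1 := h.deriv_sq_le y hy hd
  have h2 := h.le_parabola hs y (Ioo_subset_Icc_self (valleys_subset u (h.subset hy)))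
  refine abs_le_of_sq_le_sq' ?_ (by positivity) |> abs_le.2
  rw [mul_pow, sq_abs]
  nlinarith [mul_le_mul_of_nonneg_left h2 hq]

theorem IsDeepestValley.abs_deriv_le_min {q : ℝ} {u : ℝ → ℝ} {d s : ℝ} (hq : 0 ≤ q)
    (h : IsDeepestValley q u d s) {y : ℝ} (hy : y ∈ valleys u)
    (hd : DifferentiableAt ℝ u y) : |deriv u y| ≤ q * min |y - d| s := by
  rw [mul_min_of_nonneg _ _ hq, le_min_iff]
  refine ⟨?_, h.abs_deriv_le y hy hd⟩
  by_cases hys : |y - d| < s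
  · rw [abs_lt] at hys
    exact h.abs_deriv_le_mul_abs hq ⟨by linarith, by linarith⟩ hd
  · exact (h.abs_deriv_le y hy hd).trans (mul_le_mul_of_nonneg_left (not_lt.1 hys) hq)

theorem exists_isDeepestValley {q : ℝ} {u : ℝ → ℝ} (hq : 0 ≤ q)
    (hu : ContinuousOn u (Icc (-1) 1)) (h : QConcaveOn q (Icc (-1) 1) u) :
    ∃ d s, IsDeepestValley q u d s := by
  rcases (valleys u).eq_empty_or_nonempty with hE | ⟨y₀, hy₀⟩
  · refine ⟨0, 0, le_rfl, by simp, fun h => absurd h (lt_irrefl _), ?_, ?_⟩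
    · simp [hE]
    · simp
  have hq : 0 < q := by
    refine lt_of_le_of_ne hq ?_
    rintro rfl
    rw [valleys_eq_empty h] at hy₀
    exact hy₀
  set I : Set ℝ := Icc (-1) 1
  -- Ordered triples with non-strict inequalities form a compact set; positive depth restores
  -- strictness afterwards.
  set T : Set (ℝ × ℝ × ℝ) := (I ×ˢ I ×ˢ I) ∩ {p | p.1 ≤ p.2.1 ∧ p.2.1 ≤ p.2.2} with hT
  have hTc : IsCompact T := by
    refine (isCompact_Icc.prod (isCompact_Icc.prod isCompact_Icc)).inter_right ?_
    exact (isClosed_le continuous_fst (continuous_fst.comp continuous_snd)).inter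
      (isClosed_le (continuous_fst.comp continuous_snd) (continuous_snd.comp continuous_snd))
  obtain ⟨x₀, hx₀, z₀, hz₀, hxy₀, hyz₀, hu₁, hu₂⟩ := id hy₀
  have hmem₀ : (x₀, y₀, z₀) ∈ T :=
    ⟨⟨hx₀, ⟨hx₀.1.trans hxy₀.le, hyz₀.le.trans hz₀.2⟩, hz₀⟩, hxy₀.le, hyz₀.le⟩
  have hcont : ContinuousOn (fun p : ℝ × ℝ × ℝ => min (u p.1) (u p.2.2) - u p.2.1) T := by
    refine ContinuousOn.sub (ContinuousOn.inf ?_ ?_) ?_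
    · exact hu.comp (by fun_prop) fun p hp => hp.1.1
    · exact hu.comp (by fun_prop) fun p hp => hp.1.2.2
    · exact hu.comp (by fun_prop) fun p hp => hp.1.2.1
  obtain ⟨⟨a, d, b⟩, ⟨⟨ha, hdI, hb⟩, had, hdb⟩, hmax⟩ :=
    hTc.exists_isMaxOn ⟨_, hmem₀⟩ hcont
  simp only at ha hdI hb had hdb
  set κ := min (u a) (u b) - u d with hκ
  have hdepth : ∀ x y z, x ∈ I → z ∈ I → x ≤ y → y ≤ z → min (u x) (u z) - u y ≤ κ := by
    intro x y z hx hz hxy hyz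
    exact hmax (a := (x, y, z)) ⟨⟨hx, ⟨hx.1.trans hxy, hyz.trans hz.2⟩, hz⟩, hxy, hyz⟩
  have hκ0 : 0 < κ := by
    have := hdepth x₀ y₀ z₀ hx₀ hz₀ hxy₀.le hyz₀.le
    have := lt_min hu₁ hu₂
    linarith
  have hua : u d + κ ≤ u a := by linarith [min_le_left (u a) (u b)]
  have hub : u d + κ ≤ u b := by linarith [min_le_right (u a) (u b)]
  have had' : a < d := lt_of_le_of_ne had (by rintro rfl; linarith)
  have hdb' : d < b := lt_of_le_of_ne hdb (by rintro rfl; linarith)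
  have hd : d ∈ Ioo (-1 : ℝ) 1 := ⟨ha.1.trans_lt had', hdb'.trans_le hb.2⟩
  have hmin : ∀ t ∈ Icc a b, u d ≤ u t := fun t ht => by
    have := hdepth a t b ha hb ht.1 ht.2
    linarith
  have hpar : ∀ y ∈ I, u y ≤ u d + q / 2 * (y - d) ^ 2 := by
    obtain ⟨p, hp⟩ := h.exists_supergradient hd
    suffices p = 0 by subst this; simpa only [zero_mul, add_zero] using hp
    have h2 : HasDerivAt (fun y => y - d) 1 d := (hasDerivAt_id' d).sub_const d
    have h1 : HasDerivAt (fun y => p * (y - d) + q / 2 * (y - d) ^ 2) p d := by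
      convert! (h2.const_mul p).add ((h2.fun_pow 2).const_mul (q / 2)) using 1
      simp
    have h3 : IsLocalMin (fun y => p * (y - d) + q / 2 * (y - d) ^ 2) d := by
      filter_upwards [Icc_mem_nhds had' hdb'] with y hy
      have := hp y ⟨ha.1.trans hy.1, hy.2.trans hb.2⟩
      have := hmin y hy
      simp only [sub_self, mul_zero, add_zero, ne_eq, OfNat.ofNat_ne_zero, not_false_eq_true,
        zero_pow]
      linarith
    exact h3.hasDerivAt_eq_zero h1
  -- At distance `s` from `d` the parabola with vertex `(d, u d)` reaches the rim height `u d + κ`.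
  set s := √(2 * κ / q) with hs
  have hs0 : 0 < s := Real.sqrt_pos.2 (by positivity)
  have hs2 : q / 2 * s ^ 2 = κ := by
    rw [hs, Real.sq_sqrt (by positivity)]; field_simp
  have hsa : s ≤ d - a := by
    refine le_of_sq_le_sq ?_ (by linarith)
    have := hpar a ha
    have : q / 2 * s ^ 2 ≤ q / 2 * (d - a) ^ 2 := by nlinarith
    exact le_of_mul_le_mul_left this (by positivity)
  have hsb : s ≤ b - d := by
    refine le_of_sq_le_sq ?_ (by linarith)
    have := hpar b hb
    have : q / 2 * s ^ 2 ≤ q / 2 * (b - d) ^ 2 := by nlinarith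
    exact le_of_mul_le_mul_left this (by positivity)
  have hlow : ∀ y ∈ Ioo (d - s) (d + s), a < y ∧ y < b ∧ u y < u a ∧ u y < u b := by
    intro y hy
    have h1 : a < y := by linarith [hy.1]
    have h2 : y < b := by linarith [hy.2]
    have h3 := hpar y ⟨ha.1.trans h1.le, h2.le.trans hb.2⟩
    have h4 : (y - d) ^ 2 < s ^ 2 := sq_lt_sq' (by linarith [hy.1]) (by linarith [hy.2])
    have h5 : q / 2 * (y - d) ^ 2 < q / 2 * s ^ 2 := mul_lt_mul_of_pos_left h4 (by positivity)
    exact ⟨h1, h2, by linarith, by linarith⟩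
  refine ⟨d, s, hs0.le, fun y hy => ?_, fun _ => hpar, ?_, ?_⟩
  · obtain ⟨h1, h2, h3, h4⟩ := hlow y hy
    exact ⟨a, ha, b, hb, h1, h2, h3, h4⟩
  · rintro y ⟨x, hx, z, hz, hxy, hyz, h1, h2⟩ hdy
    obtain ⟨t, ht, htu⟩ := h.exists_lower_point hq hx hz hxy hyz h1 h2 hdy
    have hyI : y ∈ I := ⟨hx.1.trans hxy.le, hyz.le.trans hz.2⟩
    have hκ' : u y - u t ≤ κ := by
      -- Either `(x, t, y)` or `(y, t, z)` is a triple of depth `u y - u t`, so maximality of `κ`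
      -- applies.
      rcases le_total t y with hty | hty
      · have := hdepth x t y hx hyI ht.1.le hty
        rwa [min_eq_right h1.le] at this
      · have := hdepth y t z hyI hz hty ht.2.le
        rwa [min_eq_left h2.le] at this
    refine abs_le_of_sq_le_sq' ?_ (by positivity) |> abs_le.2
    have h3 : deriv u y ^ 2 / (2 * q) ≤ q / 2 * s ^ 2 := by linarith
    rw [div_le_iff₀ (by positivity)] at h3
    nlinarith
  · intro y hy hdy
    obtain ⟨h1, h2, h3, h4⟩ := hlow y hy
    obtain ⟨t, ht, htu⟩ := h.exists_lower_point hq ha hb h1 h2 h3 h4 hdy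
    have h5 := hmin t ⟨ht.1.le, ht.2.le⟩
    have h6 : deriv u y ^ 2 / (2 * q) ≤ u y - u d := by linarith
    rw [div_le_iff₀ (by positivity)] at h6
    linarith

/-! ### Integral form of the resistance -/

/-- `ρ` bounds the speed at which `u` falls off away from its maximum point `c`, and gives that
speed outside the valleys. -/
structure IsDescent (u : ℝ → ℝ) (c : ℝ) (ρ : ℝ → ℝ) : Prop where
  integrableOn : IntegrableOn ρ (Ioo (-1) 1)
  nonneg : ∀ᵐ x, x ∈ Ioo (-1 : ℝ) 1 → 0 ≤ ρ x
  integral_le : ∫ x in Ioo (-1) 1, ρ x ≤ (u c - u (-1)) + (u c - u 1)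
  deriv_eq : ∀ᵐ x, x ∈ Ioo (-1 : ℝ) 1 → DifferentiableAt ℝ u x → x ∉ valleys u →
    (x < c → deriv u x = ρ x) ∧ (c < x → deriv u x = -ρ x)

theorem exists_isDescent {u : ℝ → ℝ} {c : ℝ}
    (hc : c ∈ Icc (-1 : ℝ) 1) (hmax : ∀ x ∈ Icc (-1 : ℝ) 1, u x ≤ u c) :
    ∃ ρ, IsDescent u c ρ := by
  obtain ⟨ρ, h1, h2, h3, h4⟩ := exists_descent hc hmax
  have h : (-1 : ℝ) ≤ 1 := by norm_num
  refine ⟨ρ, (intervalIntegrable_iff_integrableOn_Ioo_of_le h).1 h1, h2, ?_, h4⟩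
  rwa [intervalIntegral.integral_of_le h, integral_Ioc_eq_integral_Ioo] at h3

theorem resistance_eq_setIntegral (u : ℝ → ℝ) :
    resistance (-1) 1 u = ∫ x in Ioo (-1) 1, drag (deriv u x) := by
  unfold resistance
  rw [intervalIntegral.integral_of_le (by norm_num), integral_Ioc_eq_integral_Ioo]
  rfl

theorem resistance_congr {u v : ℝ → ℝ} (h : EqOn u v (Ioo (-1) 1)) :
    resistance (-1) 1 u = resistance (-1) 1 v := by
  rw [resistance_eq_setIntegral, resistance_eq_setIntegral]
  refine setIntegral_congr_fun measurableSet_Ioo fun x hx => ?_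
  have : u =ᶠ[𝓝 x] v := by
    filter_upwards [Ioo_mem_nhds hx.1 hx.2] with y hy using h hy
  simp only [this.deriv_eq]

theorem integral_drag_mul_symm (q s : ℝ) :
    ∫ x in (-s)..s, drag (q * x) = 2 * valleyDrag q s := by
  have hii := fun a b => (continuous_drag_mul q).intervalIntegrable (μ := volume) a b
  rw [← intervalIntegral.integral_add_adjacent_intervals (hii _ 0) (hii 0 _)]
  have : ∫ x in (-s)..0, drag (q * x) = ∫ x in (0 : ℝ)..s, drag (q * x) := by
    rw [← neg_zero, ← intervalIntegral.integral_comp_neg]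
    simp only [neg_zero]
    refine intervalIntegral.integral_congr fun x _ => ?_
    simp [drag]
  rw [this]
  unfold valleyDrag
  ring

theorem integrableOn_drag {f : ℝ → ℝ} (hf : Measurable f) {s : Set ℝ} (hs : volume s ≠ ⊤) :
    IntegrableOn (fun x => drag (f x)) s := by
  refine Measure.integrableOn_of_bounded (M := 1) hs
    (continuous_drag.measurable.comp hf).aestronglyMeasurable (Eventually.of_forall fun x => ?_)
  rw [Real.norm_of_nonneg (drag_pos _).le]
  exact drag_le_one _

theorem setIntegral_drag_min {q d s : ℝ} (hs : 0 ≤ s) {E : Set ℝ} (hE : MeasurableSet E)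
    (hEfin : volume E ≠ ⊤) (hsub : Ioo (d - s) (d + s) ⊆ E) :
    ∫ x in E, drag (q * min |x - d| s) =
      2 * valleyDrag q s + (volume.real E - 2 * s) * drag (q * s) := by
  have hint : IntegrableOn (fun x => drag (q * min |x - d| s)) E :=
    integrableOn_drag (by fun_prop) hEfin
  have hconst : IntegrableOn (fun _ : ℝ => drag (q * s)) E := integrableOn_const hEfin
  -- After subtracting the constant `drag (q * s)`, the integrand lives on the central interval
  -- only.
  have h1 : ∫ x in E, (drag (q * min |x - d| s) - drag (q * s)) =
      ∫ x in Ioo (d - s) (d + s), (drag (q * min |x - d| s) - drag (q * s)) := by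
    refine (setIntegral_eq_of_subset_of_forall_sdiff_eq_zero hE hsub fun x hx => ?_)
    have : s ≤ |x - d| := by
      by_contra! h
      rw [abs_lt] at h
      exact hx.2 ⟨by linarith, by linarith⟩
    rw [min_eq_right this, sub_self]
  have h2 : ∫ x in Ioo (d - s) (d + s), (drag (q * min |x - d| s) - drag (q * s)) =
      ∫ x in (d - s)..(d + s), (drag (q * (x - d)) - drag (q * s)) := by
    rw [intervalIntegral.integral_of_le (by linarith), integral_Ioc_eq_integral_Ioo]
    refine setIntegral_congr_fun measurableSet_Ioo fun x hx => ?_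
    have : |x - d| ≤ s := abs_le.2 ⟨by linarith [hx.1], by linarith [hx.2]⟩
    simp only [min_eq_left this]
    unfold drag
    rw [mul_pow, sq_abs, ← mul_pow]
  have h3 : ∫ x in (d - s)..(d + s), drag (q * (x - d)) = 2 * valleyDrag q s := by
    rw [intervalIntegral.integral_comp_sub_right (fun x => drag (q * x)) d]
    rw [show d - s - d = -s by ring, show d + s - d = s by ring, integral_drag_mul_symm]
  have h4 : Continuous fun x => drag (q * (x - d)) := continuous_drag.comp (by fun_prop)
  rw [intervalIntegral.integral_sub (h4.intervalIntegrable _ _) (by simp), h3, intervalIntegral.integral_const] at h2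
  rw [integral_sub hint hconst, h2, setIntegral_const] at h1
  simp only [smul_eq_mul] at h1
  linarith

/-! ### The lower bound and its equality case -/

section Bound

variable {M q m : ℝ} {u ρ : ℝ → ℝ} {c d s : ℝ}

/-- Half of the total length of the valleys. -/
noncomputable def valleyHalfWidth (u : ℝ → ℝ) : ℝ := volume.real (valleys u) / 2

theorem volume_valleys_ne_top (u : ℝ → ℝ) : volume (valleys u) ≠ ⊤ :=
  ((measure_mono (valleys_subset u)).trans_lt measure_Ioo_lt_top).ne

theorem valleyHalfWidth_mem (u : ℝ → ℝ) : valleyHalfWidth u ∈ Icc (0 : ℝ) 1 := by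
  refine ⟨by unfold valleyHalfWidth; positivity, ?_⟩
  have := measureReal_mono (μ := volume) (valleys_subset u) measure_Ioo_lt_top.ne
  rw [Real.volume_real_Ioo_of_le (by norm_num)] at this
  unfold valleyHalfWidth
  linarith

theorem IsDeepestValley.le_valleyHalfWidth (h : IsDeepestValley q u d s) :
    s ≤ valleyHalfWidth u := by
  have := measureReal_mono (μ := volume) h.subset (volume_valleys_ne_top u)
  rw [Real.volume_real_Ioo_of_le (by linarith [h.nonneg])] at this
  unfold valleyHalfWidth
  linarith

/-- A pointwise lower bound for the pressure on a profile. -/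
noncomputable def pressureBound (q m : ℝ) (u ρ : ℝ → ℝ) (d s x : ℝ) : ℝ :=
  (valleys u).indicator (fun x => drag (q * min |x - d| s)) x +
    (valleys u)ᶜ.indicator (fun x => tangentIntercept m - tangentDecay m * ρ x) x

theorem integrableOn_pressureBound (hu : ContinuousOn u (Icc (-1) 1)) (hρ : IsDescent u c ρ) :
    IntegrableOn (pressureBound q m u ρ d s) (Ioo (-1) 1) := by
  have hE := (isOpen_valleys hu).measurableSet
  refine Integrable.add ?_ ?_
  · exact (integrableOn_drag (by fun_prop) measure_Ioo_lt_top.ne).indicator hE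
  · exact (Integrable.sub (integrable_const _) (hρ.integrableOn.const_mul _)).indicator hE.compl

theorem le_integral_pressureBound (hu : ContinuousOn u (Icc (-1) 1)) (hρ : IsDescent u c ρ)
    (hv : IsDeepestValley q u d s) (hm : 0 < m) :
    2 * valleyDrag q s + 2 * (valleyHalfWidth u - s) * drag (q * s) +
      2 * (1 - valleyHalfWidth u) * tangentIntercept m -
      tangentDecay m * ((u c - u (-1)) + (u c - u 1)) ≤
    ∫ x in Ioo (-1) 1, pressureBound q m u ρ d s x := by
  have hE := (isOpen_valleys hu).measurableSet
  have hdec := tangentDecay_pos hm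
  unfold pressureBound
  have i1 : IntegrableOn (fun x => drag (q * min |x - d| s)) (Ioo (-1) 1) :=
    integrableOn_drag (by fun_prop) measure_Ioo_lt_top.ne
  have i2 : IntegrableOn (fun x => tangentIntercept m - tangentDecay m * ρ x) (Ioo (-1) 1) :=
    Integrable.sub (integrable_const _) (hρ.integrableOn.const_mul _)
  rw [integral_add (i1.indicator hE) (i2.indicator hE.compl), integral_indicator hE, integral_indicator hE.compl, Measure.restrict_restrict hE,
    inter_eq_self_of_subset_left (valleys_subset u),
    setIntegral_drag_min hv.nonneg hE (volume_valleys_ne_top u) hv.subset,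
    integral_sub (integrable_const _) ((hρ.integrableOn.const_mul _).integrableOn),
    integral_const_mul, setIntegral_const]
  have h1 : ∫ x in (valleys u)ᶜ, ρ x ∂volume.restrict (Ioo (-1) 1) ≤
      (u c - u (-1)) + (u c - u 1) := by
    refine (setIntegral_le_integral hρ.integrableOn ?_).trans hρ.integral_le
    rw [EventuallyLE, ae_restrict_iff' measurableSet_Ioo]
    exact hρ.nonneg
  have h2 : (volume.restrict (Ioo (-1 : ℝ) 1)).real (valleys u)ᶜ =
      2 * (1 - valleyHalfWidth u) := by
    rw [measureReal_compl hE, measureReal_restrict_apply hE,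
      inter_eq_self_of_subset_left (valleys_subset u), measureReal_restrict_apply MeasurableSet.univ,
      univ_inter, Real.volume_real_Ioo_of_le (by norm_num)]
    unfold valleyHalfWidth
    ring
  have h3 := mul_le_mul_of_nonneg_left h1 hdec.le
  rw [h2, smul_eq_mul]
  unfold valleyHalfWidth
  linarith

theorem pressureBound_of_mem {x : ℝ} (hx : x ∈ valleys u) :
    pressureBound q m u ρ d s x = drag (q * min |x - d| s) := by
  simp [pressureBound, hx]

theorem pressureBound_of_notMem {x : ℝ} (hx : x ∉ valleys u) :
    pressureBound q m u ρ d s x = tangentIntercept m - tangentDecay m * ρ x := by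
  simp [pressureBound, hx]

theorem ae_abs_deriv_eq (hq : QConcaveOn q (Icc (-1) 1) u) (hu : ContinuousOn u (Icc (-1) 1))
    (hρ : IsDescent u c ρ) :
    ∀ᵐ x, x ∈ Ioo (-1 : ℝ) 1 → x ∉ valleys u → |deriv u x| = ρ x ∧
      (x < c → 0 ≤ deriv u x) ∧ (c < x → deriv u x ≤ 0) := by
  have hne : ∀ᵐ x : ℝ, x ≠ c := by simp [ae_iff, measure_singleton]
  filter_upwards [hρ.deriv_eq, hρ.nonneg, hq.ae_differentiableAt hu, hne] with x h1 h2 h3 h4 hx hv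
  have h5 := h1 hx (h3 hx) hv
  have h6 := h2 hx
  rcases lt_or_gt_of_ne h4 with h | h
  · rw [h5.1 h, abs_of_nonneg h6]
    exact ⟨rfl, fun _ => h6, fun h' => absurd h' h.not_gt⟩
  · rw [h5.2 h, abs_neg, abs_of_nonneg h6]
    exact ⟨rfl, fun h' => absurd h' h.not_gt, fun _ => neg_nonpos.2 h6⟩

theorem ae_pressureBound_le (hq0 : 0 ≤ q) (hq : QConcaveOn q (Icc (-1) 1) u)
    (hu : ContinuousOn u (Icc (-1) 1)) (hρ : IsDescent u c ρ) (hv : IsDeepestValley q u d s)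
    (hm : 1 ≤ m) :
    ∀ᵐ x ∂volume.restrict (Ioo (-1) 1),
      pressureBound q m u ρ d s x ≤ drag (deriv u x) := by
  rw [ae_restrict_iff' measurableSet_Ioo]
  filter_upwards [ae_abs_deriv_eq hq hu hρ, hq.ae_differentiableAt hu] with x h1 h2 hx
  by_cases hxE : x ∈ valleys u
  · rw [pressureBound_of_mem hxE]
    refine drag_le_drag ?_
    rw [abs_of_nonneg (mul_nonneg hq0 (le_min (abs_nonneg _) hv.nonneg))]
    exact hv.abs_deriv_le_min hq0 hxE (h2 hx)
  · rw [pressureBound_of_notMem hxE, ← (h1 hx hxE).1]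
    exact tangent_le_drag hm _

theorem drop_le (hc : u c ≤ M) (h0 : 0 ≤ u (-1)) (h1 : 0 ≤ u 1) :
    (u c - u (-1)) + (u c - u 1) ≤ 2 * M := by linarith

/-- Extending the parabola beyond `s` steepens the slope, which can only lower the pressure. -/
theorem valley_bound_le (hq0 : 0 ≤ q) (hv : IsDeepestValley q u d s) :
    2 * valleyDrag q (valleyHalfWidth u) ≤
      2 * valleyDrag q s + 2 * (valleyHalfWidth u - s) * drag (q * s) := by
  have := valleyDrag_sub_le hq0 hv.nonneg hv.le_valleyHalfWidth
  linarith

theorem le_resistance (hq0 : 0 ≤ q) (hq : QConcaveOn q (Icc (-1) 1) u)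
    (hu : ContinuousOn u (Icc (-1) 1)) (hρ : IsDescent u c ρ) (hv : IsDeepestValley q u d s)
    (hc : u c ≤ M) (h0 : 0 ≤ u (-1)) (h1 : 0 ≤ u 1) (hm : 1 ≤ m) :
    2 * valleyDrag q (valleyHalfWidth u) + 2 * (1 - valleyHalfWidth u) * tangentIntercept m -
      2 * tangentDecay m * M ≤ resistance (-1) 1 u := by
  have hm0 : 0 < m := by linarith
  have e1 := le_integral_pressureBound hu hρ hv hm0
  have e2 := integral_mono_ae (integrableOn_pressureBound (q := q) (m := m) (d := d) (s := s) hu hρ)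
    (integrableOn_drag (measurable_deriv u) measure_Ioo_lt_top.ne)
    (ae_pressureBound_le hq0 hq hu hρ hv hm)
  have e3 := valley_bound_le hq0 hv
  have e4 := mul_le_mul_of_nonneg_left (drop_le hc h0 h1) (tangentDecay_pos hm0).le
  rw [resistance_eq_setIntegral]
  linarith

/-- What equality in `le_resistance` says about the profile. -/
structure IsTight (M q m : ℝ) (u : ℝ → ℝ) (c d s : ℝ) : Prop where
  max_eq : u c = M
  left_eq : u (-1) = 0
  right_eq : u 1 = 0
  width_eq : 0 < q → s = valleyHalfWidth u
  valley : ∀ᵐ x, x ∈ valleys u → |deriv u x| = q * min |x - d| s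
  slope : ∀ᵐ x, x ∈ Ioo (-1 : ℝ) 1 → x ∉ valleys u → |deriv u x| = m ∨ m = 1 ∧ deriv u x = 0
  sign : ∀ᵐ x, x ∈ Ioo (-1 : ℝ) 1 → x ∉ valleys u →
    (x < c → 0 ≤ deriv u x) ∧ (c < x → deriv u x ≤ 0)

/-- Every inequality in the lower bound must be an equality: the drop is `2 * M`, the pressure
equals its bound almost everywhere, and for `q > 0` strict decay of the pressure forces `s` to be
the full half-width. -/
theorem isTight_of_resistance_le (hq0 : 0 ≤ q) (hq : QConcaveOn q (Icc (-1) 1) u)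
    (hu : ContinuousOn u (Icc (-1) 1)) (hρ : IsDescent u c ρ) (hv : IsDeepestValley q u d s)
    (hc : u c ≤ M) (h0 : 0 ≤ u (-1)) (h1 : 0 ≤ u 1) (hm : 1 ≤ m)
    (hle : resistance (-1) 1 u ≤ 2 * valleyDrag q (valleyHalfWidth u) +
      2 * (1 - valleyHalfWidth u) * tangentIntercept m - 2 * tangentDecay m * M) :
    IsTight M q m u c d s := by
  have hm0 : 0 < m := by linarith
  have hdec := tangentDecay_pos hm0
  have i1 := integrableOn_pressureBound (q := q) (m := m) (d := d) (s := s) hu hρ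
  have i2 : IntegrableOn (fun x => drag (deriv u x)) (Ioo (-1) 1) :=
    integrableOn_drag (measurable_deriv u) measure_Ioo_lt_top.ne
  have hB := ae_pressureBound_le hq0 hq hu hρ hv hm
  have e1 := le_integral_pressureBound hu hρ hv hm0
  have e2 := integral_mono_ae i1 i2 hB
  have e3 := valley_bound_le hq0 hv
  have e4 := mul_le_mul_of_nonneg_left (drop_le hc h0 h1) hdec.le
  rw [resistance_eq_setIntegral] at hle
  have hdrop : 2 * M ≤ (u c - u (-1)) + (u c - u 1) := by
    refine le_of_mul_le_mul_left ?_ hdec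
    linarith
  have hae : ∀ᵐ x, x ∈ Ioo (-1 : ℝ) 1 → pressureBound q m u ρ d s x = drag (deriv u x) := by
    rw [← ae_restrict_iff' measurableSet_Ioo]
    have h5 : ∫ x in Ioo (-1) 1, (drag (deriv u x) - pressureBound q m u ρ d s x) = 0 := by
      rw [integral_sub i2 i1]; linarith
    rw [integral_eq_zero_iff_of_nonneg_ae (hB.mono fun x hx => sub_nonneg.2 hx) (i2.sub i1)] at h5
    filter_upwards [h5] with x hx
    have : drag (deriv u x) - pressureBound q m u ρ d s x = 0 := hx
    linarith
  have hside := ae_abs_deriv_eq hq hu hρ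
  refine ⟨by linarith, by linarith, by linarith, fun hqpos => ?_, ?_, ?_, ?_⟩
  · by_contra hne
    have := valleyDrag_sub_lt hqpos hv.nonneg (lt_of_le_of_ne hv.le_valleyHalfWidth hne)
    linarith
  · filter_upwards [hae] with x h2 hx
    have h3 := h2 (valleys_subset u hx)
    rw [pressureBound_of_mem hx] at h3
    rw [← abs_eq_of_drag_eq h3,
      abs_of_nonneg (mul_nonneg hq0 (le_min (abs_nonneg _) hv.nonneg))]
  · filter_upwards [hae, hside] with x h2 h3 hx hxE
    have h4 := h2 hx
    rw [pressureBound_of_notMem hxE, ← (h3 hx hxE).1] at h4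
    exact drag_eq_tangent hm h4.symm
  · filter_upwards [hside] with x h3 hx hxE
    exact (h3 hx hxE).2

end Bound

/-! ### Choice of the tangent slope -/

section Choice

variable {M q γ : ℝ} {u ρ : ℝ → ℝ} {c d s : ℝ}

theorem tangentDecay_le {m : ℝ} (hm : 1 ≤ m) : tangentDecay m ≤ 2 / m := by
  unfold tangentDecay
  rw [div_le_div_iff₀ (by positivity) (by linarith)]
  nlinarith [sq_nonneg (m ^ 2)]

/-- `R_{M;q}` at the half-width of the valleys, raised to `1 - M` if needed, bounds the
resistance from below. -/
theorem reducedResistance_max_le (hM : 0 < M) (hq0 : 0 ≤ q) (hq : QConcaveOn q (Icc (-1) 1) u)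
    (hu : ContinuousOn u (Icc (-1) 1)) (hρ : IsDescent u c ρ) (hv : IsDeepestValley q u d s)
    (hc : u c ≤ M) (h0 : 0 ≤ u (-1)) (h1 : 0 ≤ u 1) :
    reducedResistance M q (max (valleyHalfWidth u) (1 - M)) ≤ resistance (-1) 1 u := by
  have key := fun m hm => le_resistance (m := m) hq0 hq hu hρ hv hc h0 h1 hm
  obtain ⟨hσ0, hσ1⟩ := valleyHalfWidth_mem u
  set σ := valleyHalfWidth u
  rcases le_or_gt (1 - M) σ with h | h
  · rw [max_eq_left h]
    rcases hσ1.eq_or_lt with h1 | h1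
    · rw [reducedResistance_eq hq0]
      refine le_of_forall_pos_le_add fun ε hε => ?_
      -- The slope `M / (1 - σ)` degenerates when the valleys have full measure, so `m` is sent to
      -- infinity.
      have hm : 1 ≤ max 1 (4 * M / ε) := le_max_left _ _
      have h2 := key _ hm
      have h3 := mul_le_mul_of_nonneg_right (tangentDecay_le hm) hM.le
      have h4 : 2 / max 1 (4 * M / ε) * M ≤ ε / 2 := by
        have h5 : 4 * M / ε ≤ max 1 (4 * M / ε) := le_max_right _ _
        rw [div_le_iff₀ hε] at h5
        rw [div_mul_eq_mul_div, div_le_iff₀ (by linarith)]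
        linarith
      rw [h1] at h2 ⊢
      norm_num at h2 ⊢
      linarith
    · rw [reducedResistance_eq_tangent hM hq0 h1]
      refine key _ ?_
      rw [le_div_iff₀ (by linarith)]
      linarith
  · rw [max_eq_right h.le, reducedResistance_eq_tangent hM hq0 (by linarith), sub_sub_cancel,
      div_self hM.ne', tangentIntercept_one, tangentDecay_one]
    have h2 := key 1 le_rfl
    rw [tangentIntercept_one, tangentDecay_one] at h2
    have h3 := valleyDrag_sub_le hq0 hσ0 h.le
    have h4 := mul_le_mul_of_nonneg_left (drag_le_one (q * σ)) (sub_nonneg.2 h.le)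
    linarith

theorem reducedResistance_le (hM : 0 < M) (hq0 : 0 ≤ q)
    (hmin : ∀ δ ∈ Icc (0 : ℝ) 1, δ ≠ γ → reducedResistance M q γ < reducedResistance M q δ)
    (hu : u ∈ admissibleProfiles M q) : reducedResistance M q γ ≤ resistance (-1) 1 u := by
  obtain ⟨v, ⟨hvM, hvq⟩, hvc, hvu, -⟩ := exists_continuous_extension hu
  rw [← resistance_congr hvu]
  obtain ⟨c, hc, hmax⟩ := isCompact_Icc.exists_isMaxOn
    (nonempty_Icc.2 (by norm_num : (-1 : ℝ) ≤ 1)) hvc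
  obtain ⟨ρ, hρ⟩ := exists_isDescent hc hmax
  obtain ⟨d, s, hds⟩ := exists_isDeepestValley hq0 hvc hvq
  have h1 := reducedResistance_max_le hM hq0 hvq hvc hρ hds (hvM hc).2
    (hvM (left_mem_Icc.2 (by norm_num))).1 (hvM (right_mem_Icc.2 (by norm_num))).1
  refine le_trans ?_ h1
  by_cases h : max (valleyHalfWidth v) (1 - M) = γ
  · rw [h]
  · refine (hmin _ ⟨(valleyHalfWidth_mem v).1.trans (le_max_left _ _), ?_⟩ h).le
    exact max_le (valleyHalfWidth_mem v).2 (by linarith)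

theorem isTight_of_minimal (hM : 0 < M) (hq0 : 0 ≤ q) (hγ1 : γ < 1) (hγM : 1 - M ≤ γ)
    (hstrict : 0 < q → M < 1 → 1 - M < γ)
    (hmin : ∀ δ ∈ Icc (0 : ℝ) 1, δ ≠ γ → reducedResistance M q γ < reducedResistance M q δ)
    (hq : QConcaveOn q (Icc (-1) 1) u)
    (hu : ContinuousOn u (Icc (-1) 1)) (hρ : IsDescent u c ρ) (hv : IsDeepestValley q u d s)
    (hc : u c ≤ M) (h0 : 0 ≤ u (-1)) (h1 : 0 ≤ u 1)
    (hres : resistance (-1) 1 u ≤ reducedResistance M q γ) :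
    IsTight M q (M / (1 - γ)) u c d s ∧ (0 < q → valleyHalfWidth u = γ) := by
  have hle := reducedResistance_max_le hM hq0 hq hu hρ hv hc h0 h1
  have hm : 1 ≤ M / (1 - γ) := by rw [le_div_iff₀ (by linarith)]; linarith
  have hmax : max (valleyHalfWidth u) (1 - M) = γ := by
    by_contra h
    have := hmin _ ⟨(valleyHalfWidth_mem u).1.trans (le_max_left _ _),
      max_le (valleyHalfWidth_mem u).2 (by linarith)⟩ h
    linarith
  rw [reducedResistance_eq_tangent hM hq0 hγ1] at hres
  rcases le_or_gt (1 - M) (valleyHalfWidth u) with h | h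
  · rw [max_eq_left h] at hmax
    refine ⟨isTight_of_resistance_le hq0 hq hu hρ hv hc h0 h1 hm ?_, fun _ => hmax⟩
    rwa [hmax]
  · rw [max_eq_right h.le] at hmax
    have hM1 : M < 1 := by linarith [(valleyHalfWidth_mem u).1]
    -- Here `γ = 1 - M`, which is excluded for `q > 0`. For `q = 0` the bound with `m = 1` does not
    -- depend on the width.
    have hq00 : q = 0 := by
      by_contra hne
      linarith [hstrict (lt_of_le_of_ne hq0 (Ne.symm hne)) hM1]
    subst hq00
    refine ⟨isTight_of_resistance_le hq0 hq hu hρ hv hc h0 h1 hm ?_,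
      fun h => absurd h (lt_irrefl _)⟩
    rw [← hmax, sub_sub_cancel, div_self hM.ne', tangentIntercept_one, tangentDecay_one,
      valleyDrag_zero_left] at hres ⊢
    linarith

end Choice

/-! ### Rigidity of minimizers -/

section Rigidity

variable {M q m γ : ℝ} {u : ℝ → ℝ} {c d s : ℝ}

theorem IsTight.ae_abs_deriv_le (h : IsTight M q m u c d s) (hq : 0 ≤ q) (hm : 0 ≤ m)
    (hs : q * s ≤ m) : ∀ᵐ x, x ∈ Ioo (-1 : ℝ) 1 → |deriv u x| ≤ m := by
  filter_upwards [h.valley, h.slope] with x h1 h2 hx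
  by_cases hxE : x ∈ valleys u
  · rw [h1 hxE]
    exact (mul_le_mul_of_nonneg_left (min_le_right _ _) hq).trans hs
  · rcases h2 hx hxE with h3 | ⟨-, h3⟩
    · exact h3.le
    · rw [h3, abs_zero]; exact hm

theorem QConcaveOn.abs_sub_le (hq : QConcaveOn q (Icc (-1) 1) u)
    (hu : ContinuousOn u (Icc (-1) 1))
    (h : ∀ᵐ x, x ∈ Ioo (-1 : ℝ) 1 → |deriv u x| ≤ m) {x y : ℝ} (hx : -1 ≤ x) (hxy : x ≤ y)
    (hy : y ≤ 1) : |u y - u x| ≤ m * (y - x) := by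
  rw [abs_le]
  constructor
  · have := hq.le_sub_of_le_deriv hu hx hxy hy (c := -m) (by
      filter_upwards [h] with t ht htI
      exact (abs_le.1 (ht ⟨hx.trans_lt htI.1, htI.2.trans_le hy⟩)).1)
    linarith
  · exact hq.sub_le_of_deriv_le hu hx hxy hy (by
      filter_upwards [h] with t ht htI
      exact (abs_le.1 (ht ⟨hx.trans_lt htI.1, htI.2.trans_le hy⟩)).2)

theorem IsTight.le_tent (h : IsTight M q m u c d s) (hq : QConcaveOn q (Icc (-1) 1) u)
    (hu : ContinuousOn u (Icc (-1) 1))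
    (hd : ∀ᵐ x, x ∈ Ioo (-1 : ℝ) 1 → |deriv u x| ≤ m) {x : ℝ} (hx : x ∈ Icc (-1 : ℝ) 1) :
    u x ≤ m * (1 - |x|) := by
  have h1 := (abs_le.1 (hq.abs_sub_le hu hd le_rfl hx.1 hx.2)).2
  have h2 := (abs_le.1 (hq.abs_sub_le hu hd hx.1 hx.2 le_rfl)).1
  rw [h.left_eq] at h1
  rw [h.right_eq] at h2
  rcases abs_cases x with ⟨h3, -⟩ | ⟨h3, -⟩ <;> rw [h3] <;> linarith

/-- The Lipschitz bound from the endpoints gives `u` below the tent, so height `M` occurs only at 0;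
the same bound from 0 gives the reverse inequality. -/
theorem IsTight.eqOn_tent (h : IsTight M q M u c d s) (hM : 0 < M)
    (hq : QConcaveOn q (Icc (-1) 1) u) (hu : ContinuousOn u (Icc (-1) 1))
    (hc : c ∈ Icc (-1 : ℝ) 1)
    (hd : ∀ᵐ x, x ∈ Ioo (-1 : ℝ) 1 → |deriv u x| ≤ M) :
    EqOn u (tentProfile M) (Icc (-1) 1) := by
  have hc0 : c = 0 := by
    have h1 := h.le_tent hq hu hd hc
    rw [h.max_eq] at h1
    have : M * |c| ≤ 0 := by linarith
    exact abs_nonpos_iff.1 (nonpos_of_mul_nonpos_right this hM)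
  have hu0 := h.max_eq
  rw [hc0] at hu0
  intro x hx
  refine le_antisymm (h.le_tent hq hu hd hx) ?_
  unfold tentProfile
  rcases le_total 0 x with h0 | h0
  · have := (abs_le.1 (hq.abs_sub_le hu hd (by norm_num) h0 hx.2)).1
    rw [abs_of_nonneg h0]
    linarith
  · have := (abs_le.1 (hq.abs_sub_le hu hd hx.1 h0 (by norm_num))).2
    rw [abs_of_nonpos h0]
    linarith

/-- Falling short of `1 + x` requires a point `t < x` of slope 0. By concavity `u` never exceeds `u
t ≤ 1 + t < M`, contradicting `u c = M`. -/
theorem eq_slope_one_of_concave (hq : QConcaveOn 0 (Icc (-1) 1) u)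
    (hu : ContinuousOn u (Icc (-1) 1)) (h0 : u (-1) = 0) (hc : c ≤ 1) (huc : u c = M)
    (hle : ∀ x ∈ Icc (-1 : ℝ) 1, u x ≤ 1 + x)
    (hd : ∀ᵐ x, x ∈ Ioo (-1 : ℝ) 1 → x < c → deriv u x = 1 ∨ deriv u x = 0) {x : ℝ}
    (hx : -1 ≤ x) (hxc : x ≤ c) (hxM : 1 + x ≤ M) : u x = 1 + x := by
  have hx1 : x ≤ 1 := hxc.trans hc
  refine le_antisymm (hle x ⟨hx, hx1⟩) ?_
  by_contra! hlt
  have hnot : ¬ ∀ᵐ t, t ∈ Ioo (-1) x → 1 ≤ deriv u t := by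
    intro hae
    have := hq.le_sub_of_le_deriv hu le_rfl hx hx1 hae
    linarith
  have hfreq : ∃ᵐ t, ¬ (t ∈ Ioo (-1) x → 1 ≤ deriv u t) := not_eventually.1 hnot
  obtain ⟨t, ht, htd, htdiff⟩ := (hfreq.and_eventually
    (hd.and (hq.ae_differentiableAt hu))).exists
  push Not at ht
  obtain ⟨⟨ht1, ht2⟩, ht3⟩ := ht
  have htI : t ∈ Ioo (-1 : ℝ) 1 := ⟨ht1, ht2.trans_le hx1⟩
  have hzero : deriv u t = 0 := by
    rcases htd htI (ht2.trans_le hxc) with h | h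
    · linarith
    · exact h
  have h1 := hq.le_quadratic htI (htdiff htI) (y := c) ⟨hx.trans hxc, hc⟩
  rw [hzero, huc] at h1
  have h2 := hle t (Ioo_subset_Icc_self htI)
  linarith

theorem IsTight.eqOn_trapezoid (h : IsTight M 0 1 u c d s) (hM1 : M ≤ 1)
    (hq : QConcaveOn 0 (Icc (-1) 1) u) (hu : ContinuousOn u (Icc (-1) 1))
    (hc : c ∈ Icc (-1 : ℝ) 1) (huM : ∀ x ∈ Icc (-1 : ℝ) 1, u x ≤ M) (hM : 0 < M) :
    EqOn u (parabolicProfile M 0 (1 - M)) (Icc (-1) 1) := by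
  have hd := h.ae_abs_deriv_le le_rfl zero_le_one (by simp)
  have hE := valleys_eq_empty hq
  have htent := fun x hx => h.le_tent hq hu hd (x := x) hx
  have hcM := htent c hc
  rw [h.max_eq] at hcM
  have hleft : ∀ x, -1 ≤ x → 1 + x ≤ M → u x = 1 + x := by
    intro x hx hxM
    refine eq_slope_one_of_concave hq hu h.left_eq hc.2 h.max_eq (fun y hy => ?_) ?_ hx ?_ hxM
    · linarith [htent y hy, neg_abs_le y]
    · filter_upwards [h.slope, h.sign] with t h1 h2 ht htc
      have hte : t ∉ valleys u := by simp [hE]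
      rcases h1 ht hte with h3 | ⟨-, h3⟩
      · left; rwa [abs_of_nonneg ((h2 ht hte).1 htc)] at h3
      · exact Or.inr h3
    · linarith [neg_abs_le c]
  have hright : ∀ x, x ≤ 1 → 1 - x ≤ M → u x = 1 - x := by
    intro x hx hxM
    have hu' : ContinuousOn (fun x => u (-x)) (Icc (-1) 1) :=
      hu.comp continuousOn_neg fun x hx => ⟨by linarith [hx.2], by linarith [hx.1]⟩
    have := eq_slope_one_of_concave (c := -c) (M := M) (x := -x) hq.comp_neg hu'
      (by simpa using h.right_eq)
      (by linarith [hc.1]) (by simpa using h.max_eq) (fun y hy => ?_) ?_ (by linarith) ?_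
      (by linarith)
    · simpa [sub_eq_add_neg] using this
    · have := htent (-y) ⟨by linarith [hy.2], by linarith [hy.1]⟩
      linarith [le_abs_self (-y)]
    · have hq1 := (Measure.measurePreserving_neg (volume : Measure ℝ)).quasiMeasurePreserving.ae
        (h.slope.and h.sign)
      filter_upwards [hq1] with t ⟨h1, h2⟩ ht htc
      have hte : -t ∉ valleys u := by simp [hE]
      have ht' : -t ∈ Ioo (-1 : ℝ) 1 := ⟨by linarith [ht.2], by linarith [ht.1]⟩
      rw [deriv_comp_neg]
      rcases h1 ht' hte with h3 | ⟨-, h3⟩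
      · left; rwa [abs_of_nonpos ((h2 ht' hte).2 (by linarith))] at h3
      · right; rw [h3, neg_zero]
    · linarith [le_abs_self c]
  intro x hx
  unfold parabolicProfile
  rw [sub_sub_cancel, div_self hM.ne']
  split_ifs with hxM
  · rw [abs_le] at hxM
    refine le_antisymm (by simpa using huM x hx) ?_
    have h1 := hleft (M - 1) (by linarith) (by linarith)
    have h2 := hright (1 - M) (by linarith) (by linarith)
    have h3 := hq.min_le_of_mem_Icc (x := M - 1) (y := 1 - M) (z := x)
      ⟨by linarith, by linarith⟩ ⟨by linarith, by linarith⟩ ⟨by linarith, hxM.2⟩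
    simp only [zero_div, zero_mul, sub_zero, h1, h2] at h3
    have : min (1 + (M - 1)) (1 - (1 - M)) = M := by
      rw [add_sub_cancel, sub_sub_cancel, min_self]
    rw [this] at h3
    simpa using h3
  · rcases abs_cases x with ⟨h3, -⟩ | ⟨h3, -⟩ <;> rw [h3] at hxM ⊢
    · rw [hright x hx.2 (by linarith), one_mul]
    · rw [hleft x hx.1 (by linarith)]; ring

/-- Adding the supporting parabola at `a - ε * h` and `a + ε * h` cancels its slope and leaves `(m -
r) * h ≤ q * h ^ 2`, false for small `h`. The sign `ε` covers both orientations. -/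
theorem QConcaveOn.false_of_kink (hq : QConcaveOn q (Icc (-1) 1) u) (hq0 : 0 ≤ q) {a ε r δ : ℝ}
    (ha : a ∈ Ioo (-1 : ℝ) 1) (hδ : 0 < δ) (hrm : r < m)
    (hmem : ∀ h ∈ Icc 0 δ, a - ε * h ∈ Icc (-1 : ℝ) 1 ∧ a + ε * h ∈ Icc (-1 : ℝ) 1)
    (hε : ε ^ 2 = 1)
    (h1 : ∀ h ∈ Icc 0 δ, u a + m * h ≤ u (a - ε * h))
    (h2 : ∀ h ∈ Icc 0 δ, u a - r * h ≤ u (a + ε * h)) : False := by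
  obtain ⟨p, hp⟩ := hq.exists_supergradient ha
  set h := min δ ((m - r) / (2 * (q + 1))) with hh
  have hpos : 0 < h := lt_min hδ (div_pos (by linarith) (by positivity))
  have hm : h ∈ Icc 0 δ := ⟨hpos.le, min_le_left _ _⟩
  have e1 := hp _ (hmem h hm).1
  have e2 := hp _ (hmem h hm).2
  have e3 := h1 h hm
  have e4 := h2 h hm
  have e5 : h * (2 * (q + 1)) ≤ m - r := by
    rw [← le_div_iff₀ (by positivity)]
    exact min_le_right _ _
  have e6 : (m - r) * h ≤ q * h * h := by
    have s1 : (a - ε * h - a) ^ 2 = h ^ 2 := by linear_combination h ^ 2 * hε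
    have s2 : (a + ε * h - a) ^ 2 = h ^ 2 := by linear_combination h ^ 2 * hε
    rw [s1] at e1
    rw [s2] at e2
    nlinarith
  have e7 := le_of_mul_le_mul_right e6 hpos
  nlinarith

/-- What lies outside the closed interval is open and null, hence empty. -/
theorem valleys_subset_Icc (hu : ContinuousOn u (Icc (-1) 1)) (hv : IsDeepestValley q u d s)
    (hs : s = valleyHalfWidth u) : valleys u ⊆ Icc (d - s) (d + s) := by
  have hopen : IsOpen (valleys u \ Icc (d - s) (d + s)) := (isOpen_valleys hu).sdiff isClosed_Icc
  have hnull : volume (valleys u \ Ioo (d - s) (d + s)) = 0 := by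
    rw [← measureReal_eq_zero_iff
      (ne_top_of_le_ne_top (volume_valleys_ne_top u) (measure_mono sdiff_subset)),
      measureReal_sdiff hv.subset measurableSet_Ioo (volume_valleys_ne_top u),
      Real.volume_real_Ioo_of_le (by linarith [hv.nonneg])]
    unfold valleyHalfWidth at hs
    linarith
  have := (hopen.measure_eq_zero_iff volume).1
    (measure_mono_null (sdiff_subset_sdiff_right Ioo_subset_Icc_self) hnull)
  exact sdiff_eq_empty.1 this

theorem IsTight.eqOn_parabolicProfile (h : IsTight M q (M / (1 - γ)) u c d γ)
    (hq0 : 0 < q) (hγ : γ ∈ Ioo (0 : ℝ) 1) (hγM : 1 - M < γ)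
    (hqγ : q * γ < M / (1 - γ)) (hq : QConcaveOn q (Icc (-1) 1) u)
    (hu : ContinuousOn u (Icc (-1) 1)) (hc : c ∈ Icc (-1 : ℝ) 1)
    (hmax : ∀ x ∈ Icc (-1 : ℝ) 1, u x ≤ u c) (hv : IsDeepestValley q u d γ) :
    EqOn u (parabolicProfile M q γ) (Icc (-1) 1) := by
  have hγ1 : 0 < 1 - γ := by linarith [hγ.2]
  set m := M / (1 - γ) with hm
  have hmM : m * (1 - γ) = M := div_mul_cancel₀ _ hγ1.ne'
  have hm1 : 1 < m := by rw [hm, lt_div_iff₀ hγ1]; linarith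
  have hd := h.ae_abs_deriv_le hq0.le (by linarith) hqγ.le
  have htent := fun x hx => h.le_tent hq hu hd (x := x) hx
  have hsub := valleys_subset_Icc hu hv (h.width_eq hq0)
  have hI : Icc (d - γ) (d + γ) ⊆ Icc (-1) 1 := by
    rw [← closure_Ioo (by linarith [hγ.1]), ← closure_Ioo (by norm_num)]
    exact closure_mono (hv.subset.trans (valleys_subset u))
  have hl : -1 ≤ d - γ := (hI (left_mem_Icc.2 (by linarith [hγ.1]))).1
  have hr : d + γ ≤ 1 := (hI (right_mem_Icc.2 (by linarith [hγ.1]))).2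
  have hpar : ∀ x ∈ Icc (d - γ) (d + γ), u x = u d + q / 2 * (x - d) ^ 2 := by
    intro x hx
    refine le_antisymm (hv.le_parabola hγ.1 x (hI hx)) ?_
    refine forall_mem_Icc_le_of_ae (f := fun x => u d + q / 2 * (x - d) ^ 2)
      (by linarith [hγ.1]) (by fun_prop) (hu.mono hI) ?_ x hx
    filter_upwards [h.valley, hq.ae_differentiableAt hu] with t h1 h2 ht
    have h3 := h1 (hv.subset ht)
    have h4 := hv.deriv_sq_le t ht (h2 (valleys_subset u (hv.subset ht)))
    rw [min_eq_left (abs_le.2 ⟨by linarith [ht.1], by linarith [ht.2]⟩)] at h3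
    rw [← sq_abs, h3, mul_pow, sq_abs] at h4
    have h5 : 2 * q * (q / 2 * (t - d) ^ 2) ≤ 2 * q * (u t - u d) := by linarith
    have := le_of_mul_le_mul_left h5 (by positivity)
    linarith
  have hcv : c ∉ Ioo (d - γ) (d + γ) := by
    intro hcv
    obtain ⟨x, hx, -, -, -, -, h1, -⟩ := hv.subset hcv
    exact absurd (hmax x hx) (not_le.2 h1)
  have hside : ∀ᵐ x, x ∈ Ioo (-1 : ℝ) 1 → x ∉ Icc (d - γ) (d + γ) →
      (x < c → deriv u x = m) ∧ (c < x → deriv u x = -m) := by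
    filter_upwards [h.slope, h.sign] with x h1 h2 hx hxI
    have hxv : x ∉ valleys u := fun hxv => hxI (hsub hxv)
    have h3 : |deriv u x| = m := (h1 hx hxv).resolve_right fun h => hm1.ne' h.1
    refine ⟨fun hxc => ?_, fun hxc => ?_⟩
    · rwa [abs_of_nonneg ((h2 hx hxv).1 hxc)] at h3
    · rw [abs_of_nonpos ((h2 hx hxv).2 hxc)] at h3
      linarith
  -- The maximum point must be an edge of the valley. Otherwise `u` descends from `c` to the nearer
  -- edge with slope `m` in absolute value and continues with the smaller slope `q * γ`: a convex
  -- kink.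
  have htop : u d + q / 2 * γ ^ 2 = M := by
    rcases le_or_gt c (d - γ) with hca | hca
    · rcases hca.eq_or_lt with hca | hca
      · rw [← h.max_eq, hca, hpar _ (left_mem_Icc.2 (by linarith [hγ.1]))]
        ring
      · exfalso
        have hδ : 0 < min (d - γ - c) γ := lt_min (by linarith) hγ.1
        refine hq.false_of_kink hq0.le (a := d - γ) (ε := 1)
          ⟨by linarith [hc.1], by linarith [hγ.1]⟩ hδ hqγ ?_ (by norm_num) ?_ ?_
        · rintro t ⟨ht0, ht1⟩
          have := ht1.trans (min_le_left _ _)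
          have := ht1.trans (min_le_right _ _)
          exact ⟨⟨by linarith [hc.1], by linarith⟩, ⟨by linarith, by linarith⟩⟩
        · rintro t ⟨ht0, ht1⟩
          have h1 := ht1.trans (min_le_left _ _)
          have h2 := hq.sub_le_of_deriv_le hu (a := d - γ - 1 * t) (b := d - γ) (c := -m)
            (by linarith [hc.1]) (by linarith) (by linarith [hγ.1]) (by
              filter_upwards [hside] with x hx hxI
              refine ((hx ⟨by linarith [hxI.1, hc.1], by linarith [hxI.2, hγ.1]⟩ ?_).2
                (by linarith [hxI.1])).le
              exact fun hx' => absurd hx'.1 (not_le.2 hxI.2))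
          linarith
        · rintro t ⟨ht0, ht1⟩
          have h1 := ht1.trans (min_le_right _ _)
          rw [hpar (d - γ) ⟨le_rfl, by linarith [hγ.1]⟩,
            hpar (d - γ + 1 * t) ⟨by linarith, by linarith⟩]
          nlinarith [mul_nonneg hq0.le (sq_nonneg t)]
    · have hcb : d + γ ≤ c := by
        by_contra! hlt
        exact hcv ⟨hca, hlt⟩
      rcases hcb.eq_or_lt with hcb | hcb
      · rw [← h.max_eq, ← hcb, hpar _ (right_mem_Icc.2 (by linarith [hγ.1]))]
        ring
      · exfalso
        have hδ : 0 < min (c - (d + γ)) γ := lt_min (by linarith) hγ.1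
        refine hq.false_of_kink hq0.le (a := d + γ) (ε := -1)
          ⟨by linarith [hγ.1], by linarith [hc.2]⟩ hδ hqγ ?_ (by norm_num) ?_ ?_
        · rintro t ⟨ht0, ht1⟩
          have := ht1.trans (min_le_left _ _)
          have := ht1.trans (min_le_right _ _)
          exact ⟨⟨by linarith, by linarith [hc.2]⟩, ⟨by linarith, by linarith⟩⟩
        · rintro t ⟨ht0, ht1⟩
          have h1 := ht1.trans (min_le_left _ _)
          have h2 := hq.le_sub_of_le_deriv hu (a := d + γ) (b := d + γ - -1 * t) (c := m)
            (by linarith [hγ.1]) (by linarith) (by linarith [hc.2]) (by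
              filter_upwards [hside] with x hx hxI
              refine ((hx ⟨by linarith [hxI.1, hγ.1], by linarith [hxI.2, hc.2]⟩ ?_).1
                (by linarith [hxI.2])).ge
              exact fun hx' => absurd hx'.2 (not_le.2 hxI.1))
          linarith
        · rintro t ⟨ht0, ht1⟩
          have h1 := ht1.trans (min_le_right _ _)
          rw [hpar (d + γ) ⟨by linarith [hγ.1], le_rfl⟩,
            hpar (d + γ + -1 * t) ⟨by linarith, by linarith⟩]
          nlinarith [mul_nonneg hq0.le (sq_nonneg t)]
  have hmpos : 0 < m := by linarith
  have hedge : ∀ x ∈ Icc (-1 : ℝ) 1, u x = M → |x| ≤ γ := by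
    intro x hx hxM
    have h1 := htent x hx
    rw [hxM, ← hmM] at h1
    have := le_of_mul_le_mul_left h1 hmpos
    linarith
  -- Both edges have height `M`, which the tent bound allows only in `[-γ, γ]`; an interval of
  -- length `2 * γ` must then be centred.
  have hd0 : d = 0 := by
    have h1 := hedge (d - γ) ⟨hl, by linarith [hγ.1]⟩ (by
      rw [hpar _ (left_mem_Icc.2 (by linarith [hγ.1]))]; linarith)
    have h2 := hedge (d + γ) ⟨by linarith [hγ.1], hr⟩ (by
      rw [hpar _ (right_mem_Icc.2 (by linarith [hγ.1]))]; linarith)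
    rw [abs_le] at h1 h2
    linarith
  subst hd0
  have hpM : ∀ x, |x| ≤ γ → u x = q / 2 * (x ^ 2 - γ ^ 2) + M := by
    intro x hx
    rw [abs_le] at hx
    rw [hpar x ⟨by linarith, by linarith⟩]
    linear_combination htop
  intro x hx
  unfold parabolicProfile
  split_ifs with hxγ
  · exact hpM x hxγ
  · refine le_antisymm (htent x hx) ?_
    rw [not_le] at hxγ
    have e1 := hpM γ (by rw [abs_of_pos hγ.1])
    have e2 := hpM (-γ) (by rw [abs_neg, abs_of_pos hγ.1])
    rcases abs_cases x with ⟨h3, -⟩ | ⟨h3, -⟩ <;> rw [h3] at hxγ ⊢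
    · have := (abs_le.1 (hq.abs_sub_le hu hd (by linarith [hγ.1]) hxγ.le hx.2)).1
      rw [e1] at this
      nlinarith
    · have := (abs_le.1 (hq.abs_sub_le hu hd hx.1 (by linarith : x ≤ -γ)
        (by linarith [hγ.1]))).2
      rw [e2] at this
      nlinarith

end Rigidity

/-! ### The candidate profile and the conclusion -/

theorem tentProfile_eq (M q : ℝ) : tentProfile M = parabolicProfile M q 0 := by
  funext x
  unfold tentProfile parabolicProfile
  split_ifs with h
  · obtain rfl : x = 0 := abs_nonpos_iff.1 h
    simp
  · simp

theorem concaveOn_tent_sub_sq {m q : ℝ} (hm : 0 ≤ m) (hq : 0 ≤ q) :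
    ConcaveOn ℝ (Icc (-1 : ℝ) 1) (fun x => m * (1 - |x|) - q / 2 * x ^ 2) := by
  have h1 : ConvexOn ℝ univ (fun x : ℝ => |x|) := convexOn_univ_norm
  have h2 : ConvexOn ℝ univ (fun x : ℝ => x ^ 2) := even_two.convexOn_pow
  have h3 := ((h1.smul hm).add (h2.smul (by positivity : 0 ≤ q / 2))).neg.add_const m
  refine (h3.subset (subset_univ _) (convex_Icc _ _)).congr fun x _ => ?_
  simp only [Pi.add_apply, Pi.neg_apply, smul_eq_mul]
  ring

/-- After subtracting `q / 2 * x ^ 2`, the profile is the minimum of a constant and a concave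
function. The condition `q ≤ 2 * M` keeps the bottom of the parabola above 0. -/
theorem parabolicProfile_mem {M q γ : ℝ} (hM : 0 < M) (hq : q ∈ Icc (0 : ℝ) 1)
    (hMq : q ≤ 2 * M) (hγ : γ ∈ Ico (0 : ℝ) 1) :
    parabolicProfile M q γ ∈ admissibleProfiles M q := by
  have hγ1 : 0 < 1 - γ := by linarith [hγ.2]
  have hm : 0 < M / (1 - γ) := div_pos hM hγ1
  have hmM : M / (1 - γ) * (1 - γ) = M := div_mul_cancel₀ _ hγ1.ne'
  have hq0 := hq.1
  refine ⟨fun x hx => ?_, ?_⟩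
  · unfold parabolicProfile
    have hx1 : |x| ≤ 1 := abs_le.2 hx
    split_ifs with h
    · have h1 : x ^ 2 ≤ γ ^ 2 := by rw [← sq_abs]; gcongr
      have h2 : γ ^ 2 ≤ 1 := by nlinarith [hγ.1, hγ.2]
      constructor <;> nlinarith [sq_nonneg x]
    · rw [not_le] at h
      refine ⟨mul_nonneg hm.le (by linarith), ?_⟩
      calc M / (1 - γ) * (1 - |x|) ≤ M / (1 - γ) * (1 - γ) :=
            mul_le_mul_of_nonneg_left (by linarith) hm.le
        _ = M := hmM
  · have h1 := (concaveOn_const (M - q / 2 * γ ^ 2) (convex_Icc (-1 : ℝ) 1)).inf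
      (concaveOn_tent_sub_sq hm.le hq0)
    refine h1.congr fun x hx => ?_
    simp only [Pi.inf_apply]
    unfold parabolicProfile
    split_ifs with h
    · have h2 : x ^ 2 ≤ γ ^ 2 := by rw [← sq_abs]; gcongr
      rw [inf_eq_left.2]
      · ring
      · have h3 := mul_le_mul_of_nonneg_left (sub_le_sub_left h 1) hm.le
        nlinarith
    · rw [not_le] at h
      have h2 : γ ^ 2 ≤ x ^ 2 := by
        rw [← sq_abs x]
        exact pow_le_pow_left₀ hγ.1 h.le 2
      rw [inf_eq_right.2]
      have h3 := mul_le_mul_of_nonneg_left (sub_le_sub_left h.le 1) hm.le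
      nlinarith

theorem intervalIntegral_congr_Ioo {f g : ℝ → ℝ} {a b : ℝ} (hab : a ≤ b)
    (h : EqOn f g (Ioo a b)) : ∫ x in a..b, f x = ∫ x in a..b, g x := by
  rw [intervalIntegral.integral_of_le hab, intervalIntegral.integral_of_le hab,
    integral_Ioc_eq_integral_Ioo, integral_Ioc_eq_integral_Ioo]
  exact setIntegral_congr_fun measurableSet_Ioo h

theorem resistance_parabolicProfile {M q γ : ℝ} (hq : 0 ≤ q)
    (hγ : γ ∈ Ico (0 : ℝ) 1) :
    resistance (-1) 1 (parabolicProfile M q γ) = reducedResistance M q γ := by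
  have hγ1 : 0 < 1 - γ := by linarith [hγ.2]
  set m := M / (1 - γ) with hm
  have hii : ∀ a b, IntervalIntegrable (fun x => drag (deriv (parabolicProfile M q γ) x))
      volume a b := fun a b =>
    ⟨integrableOn_drag (measurable_deriv _) measure_Ioc_lt_top.ne,
      integrableOn_drag (measurable_deriv _) measure_Ioc_lt_top.ne⟩
  have h1 : ∫ x in (-1)..(-γ), drag (deriv (parabolicProfile M q γ) x) =
      (1 - γ) * drag m := by
    rw [intervalIntegral_congr_Ioo (g := fun _ => drag m) (by linarith) fun x hx => ?_]
    · simp only [intervalIntegral.integral_const, smul_eq_mul]; ring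
    · have h2 : parabolicProfile M q γ =ᶠ[𝓝 x] fun x => m * (1 + x) := by
        filter_upwards [Iio_mem_nhds hx.2] with y hy
        have hy' : y < -γ := hy
        have hy0 : |y| = -y := abs_of_neg (by linarith [hγ.1])
        unfold parabolicProfile
        rw [if_neg (by rw [hy0]; linarith), hy0, sub_neg_eq_add]
      have h3 : HasDerivAt (fun x => m * (1 + x)) m x := by
        simpa using ((hasDerivAt_id' x).const_add 1).const_mul m
      simp only [h2.deriv_eq, h3.deriv]
  have h2 : ∫ x in (-γ)..γ, drag (deriv (parabolicProfile M q γ) x) = 2 * valleyDrag q γ := by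
    rw [← integral_drag_mul_symm]
    refine intervalIntegral_congr_Ioo (by linarith [hγ.1]) fun x hx => ?_
    have h2 : parabolicProfile M q γ =ᶠ[𝓝 x] fun x => q / 2 * (x ^ 2 - γ ^ 2) + M := by
      filter_upwards [Ioo_mem_nhds hx.1 hx.2] with y hy
      unfold parabolicProfile
      rw [if_pos (abs_le.2 ⟨hy.1.le, hy.2.le⟩)]
    have h3 : HasDerivAt (fun x => q / 2 * (x ^ 2 - γ ^ 2) + M) (q * x) x := by
      convert! ((((hasDerivAt_id' x).fun_pow 2).sub_const (γ ^ 2)).const_mul (q / 2)).add_const M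
        using 1
      simp
      ring
    simp only [h2.deriv_eq, h3.deriv]
  have h3 : ∫ x in γ..1, drag (deriv (parabolicProfile M q γ) x) = (1 - γ) * drag m := by
    rw [intervalIntegral_congr_Ioo (g := fun _ => drag m) (by linarith) fun x hx => ?_]
    · simp only [intervalIntegral.integral_const, smul_eq_mul]
    · have h2 : parabolicProfile M q γ =ᶠ[𝓝 x] fun x => m * (1 - x) := by
        filter_upwards [Ioi_mem_nhds hx.1] with y hy
        have hy' : γ < y := hy
        have hy0 : |y| = y := abs_of_pos (by linarith [hγ.1])
        unfold parabolicProfile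
        rw [if_neg (by rw [hy0]; linarith), hy0]
      have h3 : HasDerivAt (fun x => m * (1 - x)) (-m) x := by
        simpa using ((hasDerivAt_id' x).const_sub 1).const_mul m
      simp only [h2.deriv_eq, h3.deriv]
      simp [drag]
  change ∫ x in (-1)..1, drag (deriv (parabolicProfile M q γ) x) = _
  rw [← intervalIntegral.integral_add_adjacent_intervals (hii (-1) (-γ)) (hii (-γ) 1),
    ← intervalIntegral.integral_add_adjacent_intervals (hii (-γ) γ) (hii γ 1), h1, h2, h3,
    reducedResistance_eq hq]
  have h4 : (1 - γ) * drag m = (1 - γ) ^ 3 / (M ^ 2 + (1 - γ) ^ 2) := by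
    rw [hm]
    unfold drag
    have : M ^ 2 + (1 - γ) ^ 2 ≠ 0 := by positivity
    have : (1 - γ) ^ 2 + M ^ 2 ≠ 0 := by positivity
    generalize 1 - γ = t at *
    field_simp
    ring
  rw [h4]
  ring

theorem isUniqueSolution_parabolicProfile {M q γ : ℝ} (hM : 0 < M) (hq : q ∈ Icc (0 : ℝ) 1)
    (hMq : q ≤ 2 * M) (hγ : γ ∈ Ico (0 : ℝ) 1) (hγM : 1 - M ≤ γ)
    (hmin : ∀ δ ∈ Icc (0 : ℝ) 1, δ ≠ γ → reducedResistance M q γ < reducedResistance M q δ)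
    (hcase : 1 ≤ M ∧ γ = 0 ∨ M < 1 ∧ 0 < γ ∧ (0 < q → 1 - M < γ) ∧ (q = 0 → γ = 1 - M) ∧
      drag (q * γ) = tangentIntercept (M / (1 - γ))) :
    IsUniqueSolution M q (parabolicProfile M q γ) := by
  have hmem := parabolicProfile_mem hM hq hMq hγ
  have hres := resistance_parabolicProfile (M := M) hq.1 hγ
  refine ⟨⟨hmem, fun u hu => ?_⟩, fun v hv => ?_⟩
  · exact hres.trans_le (reducedResistance_le hM hq.1 hmin hu)
  have hvle : resistance (-1) 1 v ≤ reducedResistance M q γ := (hv.2 hmem).trans_eq hres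
  obtain ⟨w, ⟨hwM, hwq⟩, hwc, hwv, hvw⟩ := exists_continuous_extension hv.1
  rw [← resistance_congr hwv] at hvle
  have hI : (-1 : ℝ) ≤ 1 := by norm_num
  obtain ⟨c, hc, hmax⟩ := isCompact_Icc.exists_isMaxOn (nonempty_Icc.2 hI) hwc
  obtain ⟨ρ, hρ⟩ := exists_isDescent hc hmax
  obtain ⟨d, s, hds⟩ := exists_isDeepestValley hq.1 hwc hwq
  obtain ⟨htight, hσ⟩ := isTight_of_minimal hM hq.1 hγ.2 hγM
    (fun h0 h1 => by
      rcases hcase with h | h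
      · linarith [h.1]
      · exact h.2.2.1 h0)
    hmin hwq hwc hρ hds (hwM hc).2 (hwM (left_mem_Icc.2 hI)).1 (hwM (right_mem_Icc.2 hI)).1 hvle
  have heq : EqOn w (parabolicProfile M q γ) (Icc (-1) 1) := by
    rcases hcase with ⟨-, rfl⟩ | ⟨hM1, hγ0, h1, h2, h3⟩
    · rw [sub_zero, div_one] at htight
      rw [← tentProfile_eq]
      refine htight.eqOn_tent hM hwq hwc hc (htight.ae_abs_deriv_le hq.1 hM.le ?_)
      rcases hq.1.eq_or_lt with h | h
      · rw [← h, zero_mul]; exact hM.le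
      · rw [htight.width_eq h, hσ h, mul_zero]; exact hM.le
    · rcases hq.1.eq_or_lt with h | h
      · subst h
        rw [h2 rfl, sub_sub_cancel, div_self hM.ne'] at htight
        rw [h2 rfl]
        exact htight.eqOn_trapezoid hM1.le hwq hwc hc (fun x hx => (hwM hx).2) hM
      · have hs : s = γ := (htight.width_eq h).trans (hσ h)
        subst hs
        have hlt := lt_of_tangentIntercept_eq (div_pos hM (by linarith [hγ.2])) h3
        exact htight.eqOn_parabolicProfile h ⟨hγ0, hγ.2⟩ (h1 h)
          ((le_abs_self _).trans_lt hlt) hwq hwc hc hmax hds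
  intro x hx
  rw [← heq hx]
  -- Tightness makes the extension `w` vanish at the endpoints, and `0 ≤ v ≤ w` forces the original
  -- values there.
  rcases eq_endpoints_or_mem_Ioo_of_mem_Icc hx with rfl | rfl | h
  · exact le_antisymm (hvw _ hx) (by rw [htight.left_eq]; exact (hv.1.1 hx).1)
  · exact le_antisymm (hvw _ hx) (by rw [htight.right_eq]; exact (hv.1.1 hx).1)
  · exact (hwv h).symm

theorem theorem1 (M q : ℝ) (hM : 0 < M) (hq : q ∈ Icc (0 : ℝ) 1) (hMq : q ≤ 2 * M) :
    (1 ≤ M → IsUniqueSolution M q (tentProfile M)) ∧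
    (M < 1 → ∃ γ ∈ Ioo (0 : ℝ) 1,
      (∀ δ ∈ Icc (0 : ℝ) 1,
        IsMinOn (reducedResistance M q) (Icc (0 : ℝ) 1) δ ↔ δ = γ) ∧
      IsUniqueSolution M q (parabolicProfile M q γ)) := by
  constructor
  · intro hM1
    rw [tentProfile_eq M q]
    refine isUniqueSolution_parabolicProfile hM hq hMq ⟨le_rfl, one_pos⟩ (by linarith)
      (fun δ hδ hne => ?_) (Or.inl ⟨hM1, rfl⟩)
    exact reducedResistance_zero_lt hM1 hq ⟨lt_of_le_of_ne hδ.1 hne.symm, hδ.2⟩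
  · intro hM1
    obtain ⟨γ, hγ, h1, h2, h3, h4, hmin⟩ := exists_minimizer_reducedResistance hM hM1 hq
    have hγI : γ ∈ Icc (0 : ℝ) 1 := Ioo_subset_Icc_self hγ
    refine ⟨γ, hγ, fun δ hδ => ⟨fun h => ?_, ?_⟩, ?_⟩
    · by_contra hne
      exact absurd (h hγI) (not_le.2 (hmin δ hδ hne))
    · rintro rfl η hη
      by_cases h : η = δ
      · subst h; exact le_refl (reducedResistance M q η)
      · exact (hmin η hη h).le
    · exact isUniqueSolution_parabolicProfile hM hq hMq ⟨hγ.1.le, hγ.2⟩ h1 hmin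
        (Or.inr ⟨hM1, hγ.1, h2, h3, h4⟩)
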